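/- **Setting.** Let $\mathcal A,\mathcal B$ be finite action sets with $A=|\mathcal A|\ge 2$, $B=|\mathcal B|\ge 2$. When the leader plays $a$ and the follower plays $b$, the pair of rewards $(r_l,r_f)\in[0,1]^2$ is drawn from a fixed law depending on $(a,b)$, with means $\mu_l(a,b),\mu_f(a,b)$. Assume that for every $a$ the best response $\mathcal F_{br}(a)=\arg\max_b\mu_f(a,b)$ is unique and that $a_{se}=\arg\max_a\mu_l(a,\mathcal F_{br}(a))$ is unique; put $b_{se}=\mathcal F_{br}(a_{se})$ and $$\Delta_1=\min_a\min_{b\ne\mathcal F_{br}(a)}\big(\mu_f(a,\mathcal F_{br}(a))-\mu_f(a,b)\big),\qquad \Delta_2=\min_{a\neq a_{se}}\big(\mu_l(a_{se},b_{se})-\mu_l(a,\mathcal F_{br}(a))\big).$$ **Algorithm (EXP3-UCB).** The game is played for $T\ge1$ rounds; let $\delta\in(0,1)$, $\alpha\in(0,1]$, $\eta>0$. In round $t$ the leader draws $a_t$, given the past, from $$\tilde x_t=(1-\alpha)x_t+\alpha\,(1/A,\dots,1/A),\quad x_t(a)=\frac{e^{y_{t-1}(a)}}{\sum_{a'}e^{y_{t-1}(a')}},\quad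 y_t(a)=\sum_{\tau=1}^{t}\eta\,\frac{r_{l,\tau}\,\mathbb I\{a_\tau=a\}}{\tilde x_\tau(a)},\quad y_0=0.$$ The follower sees $a_t$ and plays any maximizer $b_t$ over $b$ of $\hat\mu_{f,t}(a_t,b)+\sqrt{2\log(T/\delta)/n_t(a_t,b)}$, where $n_t(a,b)=\max\{1,\sum_{\tau<t}\mathbb I\{a_\tau=a,b_\tau=b\}\}$ and $\hat\mu_{f,t}(a,b)=\frac1{n_t(a,b)}\sum_{\tau<t}r_{f,\tau}\mathbb I\{a_\tau=a,b_\tau=b\}$. Given the past and $(a_t,b_t)$, the rewards $(r_{l,t},r_{f,t})$ have the law attached to $(a_t,b_t)$; the leader observes $r_{l,t}$ and the follower observes $r_{f,t}$ only (limited information). **Theorem.** (i) There is an absolute constant $C_1>0$ such that the following holds for every such game and every $T$ and $\delta$. Let $\alpha=c_\alpha T^{-1/3}\le1$ and $\eta=c_\eta T^{-1/3}$ with $c_\alpha\ge1$, $c_\eta\ge1$, and assume that $c_\alpha\ge1+\log A$ or $\delta\le T^{-3}$. Then, with probability at least $1-3\delta$ over the first $T-1$ rounds, the conditional probability given these rounds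 satisfies $$\mathbb P\big[a_T\ne a_{se}\,\big|\,\text{rounds }1,\dots,T-1\big]\le\alpha+A\exp\!\Big(-\Delta_2T^{2/3}+2\sqrt{2A\log\tfrac2\delta}\;T^{1/3}+\frac{C_1AB}{\Delta_1^2}\log\frac T\delta\,\log\frac1\delta\Big).$$ (ii) (Last-iterate convergence.) For every such game and all $c_\alpha,c_\eta,\beta>0$, if $\alpha=c_\alpha T^{-1/3}$, $\eta=c_\eta T^{-1/3}$ and $T^{-\beta}\le\delta<1$, then $\mathbb P[a_T\ne a_{se}]\to0$ as $T\to\infty$, uniformly over such $\delta$ and over the tie-breaking of the follower. -/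

import Mathlib

open MeasureTheory ProbabilityTheory

noncomputable section

namespace StackelbergLearning

/-- A general-sum Stackelberg game with noisy rewards: when the leader plays `a` and the follower
plays `b`, the pair (leader's reward, follower's reward) has law `reward a b` on `[0,1] × [0,1]`.
No independence between the two coordinates is required. -/
structure Game (𝓐 𝓑 : Type*) where
  reward : 𝓐 → 𝓑 → Measure (ℝ × ℝ)
  isProbabilityMeasure : ∀ a b, IsProbabilityMeasure (reward a b)
  mem_unit : ∀ a b, ∀ᵐ r ∂(reward a b), r.1 ∈ Set.Icc (0 : ℝ) 1 ∧ r.2 ∈ Set.Icc (0 : ℝ) 1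

namespace Game

variable {𝓐 𝓑 : Type*} (G : Game 𝓐 𝓑)

/-- Mean reward of the leader. -/
def meanL (a : 𝓐) (b : 𝓑) : ℝ := ∫ r, r.1 ∂(G.reward a b)

/-- Mean reward of the follower. -/
def meanF (a : 𝓐) (b : 𝓑) : ℝ := ∫ r, r.2 ∂(G.reward a b)

/-- `br a` is the unique maximizer of the follower's mean reward against `a`, for every `a`. -/
def IsUniqueBestResponse (br : 𝓐 → 𝓑) : Prop :=
  ∀ a b, (∀ b', G.meanF a b' ≤ G.meanF a b) ↔ b = br a

/-- `(ase, br ase)` is the unique Stackelberg equilibrium: `ase` is the unique maximizer of the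
leader's mean reward under best responses. -/
def IsUniqueStackelberg (br : 𝓐 → 𝓑) (ase : 𝓐) : Prop :=
  ∀ a, (∀ a', G.meanL a' (br a') ≤ G.meanL a (br a)) ↔ a = ase

/-- The follower's gap `Δ₁ = min_a min_{b ≠ br a} (μ_f(a, br a) - μ_f(a, b))`. -/
def gapF (br : 𝓐 → 𝓑) : ℝ :=
  ⨅ p : {p : 𝓐 × 𝓑 // p.2 ≠ br p.1}, (G.meanF p.1.1 (br p.1.1) - G.meanF p.1.1 p.1.2)

/-- The leader's gap `Δ₂ = min_{a ≠ ase} (μ_l(ase, br ase) - μ_l(a, br a))`. -/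
def gapL (br : 𝓐 → 𝓑) (ase : 𝓐) : ℝ :=
  ⨅ a : {a : 𝓐 // a ≠ ase}, (G.meanL ase (br ase) - G.meanL a.1 (br a.1))

end Game

/-- What happens in one round: the leader's action, the follower's action, the leader's reward and
the follower's reward. -/
abbrev Round (𝓐 𝓑 : Type*) := 𝓐 × 𝓑 × ℝ × ℝ

section Round

variable {𝓐 𝓑 : Type*}

def actL (q : Round 𝓐 𝓑) : 𝓐 := q.1
def actF (q : Round 𝓐 𝓑) : 𝓑 := q.2.1
def rewL (q : Round 𝓐 𝓑) : ℝ := q.2.2.1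
def rewF (q : Round 𝓐 𝓑) : ℝ := q.2.2.2

end Round

section Leader

variable {𝓐 𝓑 : Type*} [Fintype 𝓐] [DecidableEq 𝓐]

/-- The exponential weights with scores `y`. -/
def softmax (y : 𝓐 → ℝ) (a : 𝓐) : ℝ := Real.exp (y a) / ∑ a', Real.exp (y a')

/-- Exponential weights mixed with uniform exploration of rate `α`. -/
def mixed (α : ℝ) (y : 𝓐 → ℝ) (a : 𝓐) : ℝ :=
  (1 - α) * softmax y a + α * (1 / (Fintype.card 𝓐 : ℝ))

/-- The scores `y_t(a) = ∑_{τ = 1}^{t} η r̃_τ(a)` along a play `q` (rounds are numbered `1, 2, …`;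
`q 0` is never used), with the importance-weighted estimate
`r̃_τ(a) = 𝟙{a_τ = a} r_{l,τ} / x̃_τ(a)`, where `x̃_τ = mixed α y_{τ-1}`. -/
def score (α η : ℝ) (q : ℕ → Round 𝓐 𝓑) : ℕ → 𝓐 → ℝ
  | 0 => fun _ => 0
  | t + 1 => fun a => score α η q t a +
      η * (if actL (q (t + 1)) = a then rewL (q (t + 1)) / mixed α (score α η q t) a else 0)

/-- The distribution `x̃_t` from which the EXP3 leader draws its action in round `t ≥ 1`. -/
def exp3 (α η : ℝ) (q : ℕ → Round 𝓐 𝓑) (t : ℕ) : 𝓐 → ℝ := mixed α (score α η q (t - 1))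

end Leader

section Follower

variable {𝓐 𝓑 : Type*} [DecidableEq 𝓐] [DecidableEq 𝓑]

/-- `n_t(a,b)`: how often `(a,b)` was played in rounds `1, …, t-1`, but at least `1`. -/
def visits (q : ℕ → Round 𝓐 𝓑) (t : ℕ) (a : 𝓐) (b : 𝓑) : ℝ :=
  max 1 (∑ τ ∈ Finset.Ico 1 t, if actL (q τ) = a ∧ actF (q τ) = b then (1 : ℝ) else 0)

/-- The empirical mean of the follower's reward for `(a,b)` over rounds `1, …, t-1`. -/
def empF (q : ℕ → Round 𝓐 𝓑) (t : ℕ) (a : 𝓐) (b : 𝓑) : ℝ :=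
  (1 / visits q t a b) *
    ∑ τ ∈ Finset.Ico 1 t, if actL (q τ) = a ∧ actF (q τ) = b then rewF (q τ) else 0

/-- The follower's upper confidence bound with horizon `T` and confidence parameter `δ`. -/
def ucbF (T : ℕ) (δ : ℝ) (q : ℕ → Round 𝓐 𝓑) (t : ℕ) (a : 𝓐) (b : 𝓑) : ℝ :=
  empF q t a b + Real.sqrt (2 * Real.log (T / δ) / visits q t a b)

end Follower

section Run

variable {𝓐 𝓑 Ω : Type*} [MeasurableSpace 𝓐] [MeasurableSpace 𝓑]

/-- The information generated by rounds `1, …, t-1`. -/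
@[reducible] def past (h : ℕ → Ω → Round 𝓐 𝓑) (t : ℕ) : MeasurableSpace Ω :=
  ⨆ τ ∈ Set.Ico 1 t, MeasurableSpace.comap (h τ) inferInstance

/-- The information generated by rounds `1, …, t-1` and both actions of round `t`. -/
@[reducible] def pastAndActions (h : ℕ → Ω → Round 𝓐 𝓑) (t : ℕ) : MeasurableSpace Ω :=
  past h t ⊔ MeasurableSpace.comap (fun ω => (actL (h t ω), actF (h t ω))) inferInstance

/-- The process `h` on the probability space `(Ω, P)` is a `T`-round play of `G` in the
limited-information setting in which the leader runs EXP3 with exploration rate `α` and learning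
rate `η`, and the follower runs UCB separately for every leader action. Ties between maximal
upper confidence bounds may be broken in any way. -/
structure IsEXP3UCBRun [Fintype 𝓐] [DecidableEq 𝓐] [DecidableEq 𝓑] [MeasurableSpace Ω]
    (G : Game 𝓐 𝓑) (T : ℕ) (δ α η : ℝ) (P : Measure Ω) (h : ℕ → Ω → Round 𝓐 𝓑) : Prop where
  measurable : ∀ t ∈ Set.Icc 1 T, Measurable (h t)
  /-- given the past, the leader's action has law `x̃_t` -/
  leader : ∀ t ∈ Set.Icc 1 T, ∀ a : 𝓐,
    P⟦{ω | actL (h t ω) = a} | past h t⟧ =ᵐ[P] fun ω => exp3 α η (fun τ => h τ ω) t a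
  /-- having seen the leader's action, the follower maximizes its upper confidence bound -/
  follower : ∀ t ∈ Set.Icc 1 T, ∀ᵐ ω ∂P, ∀ b : 𝓑,
    ucbF T δ (fun τ => h τ ω) t (actL (h t ω)) b
      ≤ ucbF T δ (fun τ => h τ ω) t (actL (h t ω)) (actF (h t ω))
  /-- given the past and the two actions, the rewards are drawn from the law of the action pair -/
  rewards : ∀ t ∈ Set.Icc 1 T, ∀ s : Set (ℝ × ℝ), MeasurableSet s →
    P⟦{ω | (rewL (h t ω), rewF (h t ω)) ∈ s} | pastAndActions h t⟧
      =ᵐ[P] fun ω => (G.reward (actL (h t ω)) (actF (h t ω))).real s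

end Run

end StackelbergLearning

end

/-! Given the first T-1 rounds, the leader misses `ase` with probability exactly one minus the
weight `exp3` puts on it, so everything reduces to showing that the score of `ase` beats every other
score by a wide margin (`one_sub_mixed_le`).

Two independent effects could spoil the margin. First, the follower may answer wrongly. When its
empirical means are concentrated, a wrong answer b to a is chosen only while its confidence width is
at least half the gap, hence O(log(T/δ)/Δ₁²) times (`Concentrated.plays_le`). Such rounds disturb a
score by at most ηA/α each, because exploration keeps every weight above α/A. Second, importance
weighting is noisy. The idea is to compare the true scores with an idealized `estimate`, in which a
wrong answer is paid the mean reward of the best response. Whatever the follower does, this estimate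
is conditionally unbiased for the best-response value (`integral_mul_estimate`) and has conditional
second moment at most A/α (`integral_mul_estimate_sq_le`), so a Bernstein supermartingale controls
the cumulative difference of two actions (`measureReal_sum_estimate_le`).

Together these bound the score difference by η times `advantageBound`: a drift -Δ₂(T-1) against a
fluctuation of order √(TA/α) and corrections of order A/α up to logarithms. With α and η of order
T^(-1/3), the drift contributes order T^(2/3), the fluctuation T^(1/3) and the corrections only
logarithms. Both parts of the theorem are readings of `measureReal_lastIterate_le`: in (i) the
failure budget is tuned to δ, in (ii) to a fixed ε. -/

noncomputable section

namespace StackelbergLearning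

set_option linter.unusedSectionVars false

/-! ### Measurability along the filtration of the play. -/

section Measurability

lemma measurable_mixed {𝓐 : Type*} [Fintype 𝓐] (α : ℝ) (a : 𝓐) :
    Measurable (fun y : 𝓐 → ℝ => mixed α y a) := by
  unfold mixed softmax
  fun_prop

variable {𝓐 𝓑 Ω : Type*} [MeasurableSpace 𝓐] [MeasurableSpace 𝓑]

lemma measurable_actL : Measurable (actL : Round 𝓐 𝓑 → 𝓐) := measurable_fst

lemma measurable_actF : Measurable (actF : Round 𝓐 𝓑 → 𝓑) := measurable_fst.comp measurable_snd

lemma measurable_rewL : Measurable (rewL : Round 𝓐 𝓑 → ℝ) :=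
  measurable_fst.comp (measurable_snd.comp measurable_snd)

lemma measurable_rewF : Measurable (rewF : Round 𝓐 𝓑 → ℝ) :=
  measurable_snd.comp (measurable_snd.comp measurable_snd)

lemma measurable_past {h : ℕ → Ω → Round 𝓐 𝓑} {τ t : ℕ} (h₁ : 1 ≤ τ) (h₂ : τ < t) :
    Measurable[past h t] (h τ) := by
  have hle : MeasurableSpace.comap (h τ) inferInstance ≤ past h t :=
    le_iSup₂ (f := fun (τ : ℕ) (_ : τ ∈ Set.Ico 1 t) =>
      MeasurableSpace.comap (h τ) inferInstance) τ ⟨h₁, h₂⟩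
  exact (comap_measurable (h τ)).mono hle le_rfl

lemma past_mono (h : ℕ → Ω → Round 𝓐 𝓑) {s t : ℕ} (hst : s ≤ t) : past h s ≤ past h t :=
  iSup₂_le fun _ hτ => (measurable_past hτ.1 (hτ.2.trans_le hst)).comap_le

lemma past_le_pastAndActions (h : ℕ → Ω → Round 𝓐 𝓑) (t : ℕ) :
    past h t ≤ pastAndActions h t := le_sup_left

lemma pastAndActions_le_past (h : ℕ → Ω → Round 𝓐 𝓑) {t : ℕ} (ht : 1 ≤ t) :
    pastAndActions h t ≤ past h (t + 1) := by
  refine sup_le (past_mono h t.le_succ) (Measurable.comap_le ?_)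
  have := measurable_past (h := h) ht t.lt_succ_self
  exact (measurable_actL.comp this).prodMk (measurable_actF.comp this)

lemma measurable_actions (h : ℕ → Ω → Round 𝓐 𝓑) (t : ℕ) :
    Measurable[pastAndActions h t] (fun ω => (actL (h t ω), actF (h t ω))) :=
  (comap_measurable _).mono le_sup_right le_rfl

lemma past_le [mΩ : MeasurableSpace Ω] {h : ℕ → Ω → Round 𝓐 𝓑} {T t : ℕ}
    (hm : ∀ t ∈ Set.Icc 1 T, Measurable (h t)) (ht : t ≤ T + 1) : past h t ≤ mΩ :=
  iSup₂_le fun τ hτ => (hm τ ⟨hτ.1, by have := hτ.2; omega⟩).comap_le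

variable [DiscreteMeasurableSpace 𝓐] [DiscreteMeasurableSpace 𝓑]

lemma measurableSet_actions (h : ℕ → Ω → Round 𝓐 𝓑) (t : ℕ) (a : 𝓐) (b : 𝓑) :
    MeasurableSet[pastAndActions h t] {ω | actL (h t ω) = a ∧ actF (h t ω) = b} := by
  have := measurable_actions h t (measurableSet_singleton (a, b))
  convert this using 1
  ext ω
  simp

lemma measurableSet_actL (h : ℕ → Ω → Round 𝓐 𝓑) (t : ℕ) (a : 𝓐) :
    MeasurableSet[pastAndActions h t] {ω | actL (h t ω) = a} :=
  (measurable_fst.comp (measurable_actions h t)) (measurableSet_singleton a)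

variable [Fintype 𝓐] [DecidableEq 𝓐]

lemma measurable_score [MeasurableSpace Ω] {h : ℕ → Ω → Round 𝓐 𝓑} (α η : ℝ) (s : ℕ)
    (hm : ∀ τ ∈ Set.Icc 1 s, Measurable (h τ)) (a : 𝓐) :
    Measurable (fun ω => score α η (fun τ => h τ ω) s a) := by
  induction s generalizing a with
  | zero => exact measurable_const
  | succ s ih =>
    have ih' := ih fun τ hτ => hm τ ⟨hτ.1, hτ.2.trans s.le_succ⟩
    have hs := hm (s + 1) ⟨by omega, le_rfl⟩
    refine (ih' a).add (measurable_const.mul (Measurable.ite ?_ ?_ measurable_const))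
    · exact (measurable_actL.comp hs) (measurableSet_singleton a)
    · exact (measurable_rewL.comp hs).div
        ((measurable_mixed α a).comp (measurable_pi_lambda _ ih'))

lemma measurable_exp3 (h : ℕ → Ω → Round 𝓐 𝓑) (α η : ℝ) {t : ℕ} (ht : 1 ≤ t) (a : 𝓐) :
    Measurable[past h t] (fun ω => exp3 α η (fun τ => h τ ω) t a) := by
  let := past h t
  exact (measurable_mixed α a).comp (measurable_pi_lambda _ fun a' =>
    measurable_score α η (t - 1)
      (fun τ hτ => measurable_past hτ.1 (by have := hτ.2; omega)) a')

end Measurability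

/-! ### Conditional laws of rewards and actions, in integrated form. -/

section Conditioning

variable {𝓐 𝓑 Ω : Type*} [Fintype 𝓐] [DecidableEq 𝓐] [MeasurableSpace 𝓐]
  [DiscreteMeasurableSpace 𝓐] [DecidableEq 𝓑] [MeasurableSpace 𝓑]
  [DiscreteMeasurableSpace 𝓑] [mΩ : MeasurableSpace Ω]
  {G : Game 𝓐 𝓑} {T : ℕ} {δ α η : ℝ} {P : Measure Ω} [IsProbabilityMeasure P]
  {h : ℕ → Ω → Round 𝓐 𝓑}

lemma IsEXP3UCBRun.past_le (run : IsEXP3UCBRun G T δ α η P h) {t : ℕ} (ht : t ≤ T + 1) :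
    past h t ≤ mΩ := StackelbergLearning.past_le run.measurable ht

lemma IsEXP3UCBRun.pastAndActions_le (run : IsEXP3UCBRun G T δ α η P h) {t : ℕ}
    (ht : t ∈ Set.Icc 1 T) : pastAndActions h t ≤ mΩ :=
  (pastAndActions_le_past h ht.1).trans (run.past_le (Nat.succ_le_succ ht.2))

lemma IsEXP3UCBRun.measurable_rewards (run : IsEXP3UCBRun G T δ α η P h) {t : ℕ}
    (ht : t ∈ Set.Icc 1 T) : Measurable fun ω => (rewL (h t ω), rewF (h t ω)) :=
  (measurable_rewL.comp (run.measurable t ht)).prodMk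
    (measurable_rewF.comp (run.measurable t ht))

/-- The reward hypothesis concerns conditional probabilities of one event at a time. On an event on
which both actions are fixed it becomes an identity of measures, from which integrals of arbitrary
functions of the rewards can be read off. -/
lemma IsEXP3UCBRun.map_restrict_rewards (run : IsEXP3UCBRun G T δ α η P h) {t : ℕ}
    (ht : t ∈ Set.Icc 1 T) (a : 𝓐) (b : 𝓑) {s : Set Ω}
    (hs : MeasurableSet[pastAndActions h t] s)
    (hsub : s ⊆ {ω | actL (h t ω) = a ∧ actF (h t ω) = b}) :
    (P.restrict s).map (fun ω => (rewL (h t ω), rewF (h t ω))) = P s • G.reward a b := by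
  have := G.isProbabilityMeasure a b
  have hle := run.pastAndActions_le ht
  have hr := run.measurable_rewards ht
  ext u hu
  have hu' : MeasurableSet {ω | (rewL (h t ω), rewF (h t ω)) ∈ u} := hr hu
  rw [Measure.map_apply hr hu, Measure.restrict_apply (hr hu), Measure.smul_apply, smul_eq_mul]
  have h1 : ∫ ω in s, (P⟦{ω | (rewL (h t ω), rewF (h t ω)) ∈ u} | pastAndActions h t⟧) ω ∂P
      = ∫ ω in s, {ω | (rewL (h t ω), rewF (h t ω)) ∈ u}.indicator (fun _ => (1 : ℝ)) ω ∂P :=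
    setIntegral_condExp hle ((integrable_const (1 : ℝ)).indicator hu') hs
  rw [setIntegral_congr_ae (g := fun _ => (G.reward a b).real u) (hle s hs) ?_,
    integral_indicator hu', setIntegral_const, setIntegral_const, smul_eq_mul, smul_eq_mul,
    mul_one] at h1
  · rw [measureReal_restrict_apply hu'] at h1
    simp only [measureReal_def, ← ENNReal.toReal_mul] at h1
    rw [ENNReal.toReal_eq_toReal_iff' (by finiteness) (by finiteness)] at h1
    exact h1.symm
  · filter_upwards [run.rewards t ht u hu] with ω hω hωs
    rw [hω, (hsub hωs).1, (hsub hωs).2]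

lemma IsEXP3UCBRun.integral_mul_reward (run : IsEXP3UCBRun G T δ α η P h) {t : ℕ}
    (ht : t ∈ Set.Icc 1 T) (a : 𝓐) (b : 𝓑) {g : Ω → ℝ}
    (hg : Measurable[pastAndActions h t] g) {C : ℝ} (hgC : ∀ ω, |g ω| ≤ C)
    {φ : ℝ × ℝ → ℝ} (hφ : Measurable φ) {K : ℝ} (hφK : ∀ r, |φ r| ≤ K) :
    ∫ ω, g ω * {ω | actL (h t ω) = a ∧ actF (h t ω) = b}.indicator
        (fun ω => φ (rewL (h t ω), rewF (h t ω))) ω ∂P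
      = (∫ r, φ r ∂(G.reward a b)) *
        ∫ ω, g ω * {ω | actL (h t ω) = a ∧ actF (h t ω) = b}.indicator (fun _ => 1) ω ∂P := by
  have := G.isProbabilityMeasure a b
  have hle := run.pastAndActions_le ht
  have hr := run.measurable_rewards ht
  set D := {ω | actL (h t ω) = a ∧ actF (h t ω) = b} with hD
  have hDm : MeasurableSet[pastAndActions h t] D := measurableSet_actions h t a b
  set c := ∫ r, φ r ∂(G.reward a b)
  set f := D.indicator (fun ω => φ (rewL (h t ω), rewF (h t ω))) with hf
  have hfm : Measurable f := (hφ.comp hr).indicator (hle _ hDm)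
  have hfK : ∀ ω, |f ω| ≤ K := fun ω => by
    by_cases hω : ω ∈ D
    · simpa [f, hω] using hφK _
    · simpa [f, hω] using (abs_nonneg _).trans (hφK 0)
  have hfi : Integrable f P := Integrable.of_bound hfm.aestronglyMeasurable K
    (Filter.Eventually.of_forall hfK)
  have hgm : Measurable g := hg.mono hle le_rfl
  have hgf : Integrable (g * f) P := Integrable.of_bound (hgm.mul hfm).aestronglyMeasurable (C * K)
    (Filter.Eventually.of_forall fun ω => by
      simp only [Pi.mul_apply, Real.norm_eq_abs, abs_mul]
      exact mul_le_mul (hgC ω) (hfK ω) (abs_nonneg _) ((abs_nonneg _).trans (hgC ω)))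
  -- On every event of the conditioning σ-algebra inside `D` the rewards have a multiple of one
  -- fixed law, so the conditional expectation is constant on `D` and zero off it.
  have hcond : D.indicator (fun _ => c) =ᵐ[P] P[f | pastAndActions h t] := by
    refine ae_eq_condExp_of_forall_setIntegral_eq hle hfi
      (fun s _ _ => ((integrable_const c).indicator (hle _ hDm)).integrableOn) ?_
      (stronglyMeasurable_const.indicator hDm).aestronglyMeasurable
    intro s hs _
    rw [setIntegral_indicator (hle _ hDm), setIntegral_indicator (hle _ hDm), setIntegral_const,
      smul_eq_mul]
    have := run.map_restrict_rewards ht a b (hs.inter hDm) Set.inter_subset_right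
    rw [← integral_map (φ := fun ω => (rewL (h t ω), rewF (h t ω))) (f := φ) hr.aemeasurable
      hφ.aestronglyMeasurable, this, integral_smul_measure, smul_eq_mul, measureReal_def]
  calc ∫ ω, g ω * f ω ∂P = ∫ ω, (P[g * f | pastAndActions h t]) ω ∂P :=
        (integral_condExp hle).symm
    _ = ∫ ω, c * (g ω * D.indicator (fun _ => 1) ω) ∂P := by
        refine integral_congr_ae ?_
        filter_upwards [condExp_mul_of_stronglyMeasurable_left hg.stronglyMeasurable hgf hfi,
          hcond] with ω h1 h2
        rw [h1, Pi.mul_apply, ← h2]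
        by_cases hω : ω ∈ D <;> simp [hω, mul_comm]
    _ = _ := integral_const_mul _ _

lemma IsEXP3UCBRun.integral_mul_actL (run : IsEXP3UCBRun G T δ α η P h) {t : ℕ}
    (ht : t ∈ Set.Icc 1 T) (a : 𝓐) {g : Ω → ℝ}
    (hg : Measurable[past h t] g) {C : ℝ} (hgC : ∀ ω, |g ω| ≤ C) :
    ∫ ω, g ω * {ω | actL (h t ω) = a}.indicator (fun _ => 1) ω ∂P
      = ∫ ω, g ω * exp3 α η (fun τ => h τ ω) t a ∂P := by
  have hle := run.past_le (ht.2.trans T.le_succ)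
  set D := {ω | actL (h t ω) = a} with hD
  have hDm : MeasurableSet D := run.pastAndActions_le ht _ (measurableSet_actL h t a)
  have hgm : Measurable g := hg.mono hle le_rfl
  have hfi : Integrable (D.indicator fun _ => (1 : ℝ)) P := (integrable_const _).indicator hDm
  have hgf : Integrable (g * D.indicator fun _ => (1 : ℝ)) P :=
    hfi.bdd_mul (c := C) hgm.aestronglyMeasurable (Filter.Eventually.of_forall hgC)
  calc _ = ∫ ω, (P[g * D.indicator fun _ => (1 : ℝ) | past h t]) ω ∂P :=
        (integral_condExp hle).symm
    _ = _ := by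
        refine integral_congr_ae ?_
        filter_upwards [condExp_mul_of_stronglyMeasurable_left hg.stronglyMeasurable hgf hfi,
          run.leader t ht a] with ω h1 h2
        rw [h1, Pi.mul_apply, h2]

lemma IsEXP3UCBRun.ae_mem_unit [Fintype 𝓑] (run : IsEXP3UCBRun G T δ α η P h) {t : ℕ}
    (ht : t ∈ Set.Icc 1 T) :
    ∀ᵐ ω ∂P, rewL (h t ω) ∈ Set.Icc (0 : ℝ) 1 ∧ rewF (h t ω) ∈ Set.Icc (0 : ℝ) 1 := by
  have hr := run.measurable_rewards ht
  have key : ∀ a b, ∀ᵐ ω ∂P, (actL (h t ω) = a ∧ actF (h t ω) = b) →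
      rewL (h t ω) ∈ Set.Icc (0 : ℝ) 1 ∧ rewF (h t ω) ∈ Set.Icc (0 : ℝ) 1 := by
    intro a b
    have hm := run.map_restrict_rewards ht a b (measurableSet_actions h t a b) subset_rfl
    have := Measure.ae_smul_measure (G.mem_unit a b)
      (P {ω | actL (h t ω) = a ∧ actF (h t ω) = b})
    rw [← hm] at this
    exact (ae_restrict_iff' (run.pastAndActions_le ht _ (measurableSet_actions h t a b))).1
      (ae_of_ae_map hr.aemeasurable this)
  filter_upwards [ae_all_iff.2 fun a => ae_all_iff.2 (key a)] with ω hω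
  exact hω _ _ ⟨rfl, rfl⟩

end Conditioning

/-! ### Exponential supermartingales. -/

section Supermartingale

variable {Ω : Type*} [mΩ : MeasurableSpace Ω] {P : Measure Ω} [IsProbabilityMeasure P]

lemma integrable_of_abs_le {f : Ω → ℝ} (hf : Measurable f) {C : ℝ} (hC : ∀ ω, |f ω| ≤ C) :
    Integrable f P :=
  Integrable.of_bound hf.aestronglyMeasurable C (Filter.Eventually.of_forall hC)

/-- The exponential of a bounded adapted sum has integral at most one, if each factor does not
increase integrals against nonnegative bounded functions of the past. -/
lemma integral_exp_sum_le_one {𝓕 : ℕ → MeasurableSpace Ω} {T : ℕ}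
    (hmono : ∀ s t, s ≤ t → 𝓕 s ≤ 𝓕 t) {X : ℕ → Ω → ℝ} {C : ℝ}
    (hX : ∀ t ∈ Set.Ico 1 T, Measurable[𝓕 (t + 1)] (X t)) (hC : ∀ t ω, |X t ω| ≤ C)
    (hstep : ∀ t ∈ Set.Ico 1 T, ∀ g : Ω → ℝ, Measurable[𝓕 t] g → (∀ ω, 0 ≤ g ω) →
      ∀ K : ℝ, (∀ ω, |g ω| ≤ K) → ∫ ω, g ω * Real.exp (X t ω) ∂P ≤ ∫ ω, g ω ∂P)
    {t : ℕ} (ht : 1 ≤ t) (htT : t ≤ T) :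
    ∫ ω, Real.exp (∑ τ ∈ Finset.Ico 1 t, X τ ω) ∂P ≤ 1 := by
  induction t, ht using Nat.le_induction with
  | base => simp
  | succ t ht ih =>
    refine le_trans ?_ (ih (by omega))
    have hmeas : Measurable[𝓕 t] fun ω => Real.exp (∑ τ ∈ Finset.Ico 1 t, X τ ω) := by
      refine Real.measurable_exp.comp (Finset.measurable_sum _ fun τ hτ => ?_)
      rw [Finset.mem_Ico] at hτ
      exact (hX τ ⟨hτ.1, by omega⟩).mono (hmono _ _ (by omega)) le_rfl
    have hb : ∀ ω, |Real.exp (∑ τ ∈ Finset.Ico 1 t, X τ ω)|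
        ≤ Real.exp (∑ τ ∈ Finset.Ico 1 t, C) := fun ω => by
      rw [abs_of_pos (Real.exp_pos _)]
      exact Real.exp_le_exp.2 (Finset.sum_le_sum fun τ _ => (le_abs_self _).trans (hC τ ω))
    have := hstep t ⟨ht, by omega⟩ _ hmeas (fun ω => (Real.exp_pos _).le) _ hb
    simpa only [Finset.sum_Ico_succ_top ht, Real.exp_add] using this

/-- Markov's inequality for the exponential supermartingale. The constant `C` serves integrability
only and does not enter the bound. -/
lemma measureReal_le_sum_le_exp_neg {𝓕 : ℕ → MeasurableSpace Ω} {T : ℕ}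
    (hmono : ∀ s t, s ≤ t → 𝓕 s ≤ 𝓕 t) (hle : ∀ t ≤ T, 𝓕 t ≤ mΩ) {X : ℕ → Ω → ℝ} {C : ℝ}
    (hX : ∀ t ∈ Set.Ico 1 T, Measurable[𝓕 (t + 1)] (X t)) (hC : ∀ t ω, |X t ω| ≤ C)
    (hstep : ∀ t ∈ Set.Ico 1 T, ∀ g : Ω → ℝ, Measurable[𝓕 t] g → (∀ ω, 0 ≤ g ω) →
      ∀ K : ℝ, (∀ ω, |g ω| ≤ K) → ∫ ω, g ω * Real.exp (X t ω) ∂P ≤ ∫ ω, g ω ∂P)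
    {t : ℕ} (ht : 1 ≤ t) (htT : t ≤ T) (u : ℝ) :
    P.real {ω | u ≤ ∑ τ ∈ Finset.Ico 1 t, X τ ω} ≤ Real.exp (-u) := by
  have h1 := integral_exp_sum_le_one hmono hX hC hstep ht htT
  have hmeas : Measurable fun ω => Real.exp (∑ τ ∈ Finset.Ico 1 t, X τ ω) := by
    refine Real.measurable_exp.comp (Finset.measurable_sum _ fun τ hτ => ?_)
    rw [Finset.mem_Ico] at hτ
    exact (hX τ ⟨hτ.1, by omega⟩).mono (hle _ (by omega)) le_rfl
  have hint : Integrable (fun ω => Real.exp (∑ τ ∈ Finset.Ico 1 t, X τ ω)) P := by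
    refine integrable_of_abs_le hmeas (C := Real.exp (∑ τ ∈ Finset.Ico 1 t, C)) fun ω => ?_
    rw [abs_of_pos (Real.exp_pos _)]
    exact Real.exp_le_exp.2 (Finset.sum_le_sum fun τ _ => (le_abs_self _).trans (hC τ ω))
  have h2 := mul_meas_ge_le_integral_of_nonneg
    (Filter.Eventually.of_forall fun ω => (Real.exp_pos _).le) hint (Real.exp u)
  simp only [Real.exp_le_exp] at h2
  rw [Real.exp_neg, ← one_div, le_div_iff₀ (Real.exp_pos u), mul_comm]
  exact h2.trans h1

end Supermartingale

/-! ### An exponential inequality and truncation of rewards to the unit interval. -/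

lemma exp_le_one_add_add_sq {x : ℝ} (hx : |x| ≤ 1) :
    Real.exp x ≤ 1 + x + 3 / 4 * x ^ 2 := by
  have := (abs_le.1 (Real.exp_bound hx (n := 2) (by norm_num))).2
  simp [Finset.sum_range_succ, Nat.factorial] at this
  linarith

/-- The nearest point of the unit interval. -/
def clip (r : ℝ) : ℝ := max 0 (min 1 r)

lemma clip_nonneg (r : ℝ) : 0 ≤ clip r := le_max_left _ _

lemma clip_le_one (r : ℝ) : clip r ≤ 1 := max_le zero_le_one (min_le_left _ _)

lemma clip_of_mem {r : ℝ} (hr : r ∈ Set.Icc (0 : ℝ) 1) : clip r = r := by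
  simp [clip, hr.1, hr.2]

lemma measurable_clip : Measurable clip := by unfold clip; fun_prop

namespace Game

variable {𝓐 𝓑 : Type*} (G : Game 𝓐 𝓑)

/-- Rewards lie in the unit interval only almost surely. Clipping makes the bounds hold pointwise,
which the supermartingale lemmas need, and leaves the means unchanged. -/
lemma integral_clip_fst (a : 𝓐) (b : 𝓑) : ∫ r, clip r.1 ∂(G.reward a b) = G.meanL a b :=
  integral_congr_ae ((G.mem_unit a b).mono fun _ hr => clip_of_mem hr.1)

lemma integral_clip_snd (a : 𝓐) (b : 𝓑) : ∫ r, clip r.2 ∂(G.reward a b) = G.meanF a b :=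
  integral_congr_ae ((G.mem_unit a b).mono fun _ hr => clip_of_mem hr.2)

lemma integral_mem_unit {μ : Measure (ℝ × ℝ)} [IsProbabilityMeasure μ] {φ : ℝ × ℝ → ℝ}
    (hφ : Measurable φ) (h0 : ∀ r, 0 ≤ φ r) (h1 : ∀ r, φ r ≤ 1) :
    ∫ r, φ r ∂μ ∈ Set.Icc (0 : ℝ) 1 := by
  refine ⟨integral_nonneg h0, ?_⟩
  have hi : Integrable φ μ := integrable_of_abs_le hφ (C := 1) fun r => by
    rw [abs_of_nonneg (h0 r)]; exact h1 r
  simpa using integral_mono hi (integrable_const (1 : ℝ)) h1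

lemma meanL_mem_unit (a : 𝓐) (b : 𝓑) : G.meanL a b ∈ Set.Icc (0 : ℝ) 1 := by
  have := G.isProbabilityMeasure a b
  rw [← G.integral_clip_fst]
  exact integral_mem_unit (measurable_clip.comp measurable_fst) (fun _ => clip_nonneg _)
    fun _ => clip_le_one _

lemma meanF_mem_unit (a : 𝓐) (b : 𝓑) : G.meanF a b ∈ Set.Icc (0 : ℝ) 1 := by
  have := G.isProbabilityMeasure a b
  rw [← G.integral_clip_snd]
  exact integral_mem_unit (measurable_clip.comp measurable_snd) (fun _ => clip_nonneg _)
    fun _ => clip_le_one _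

end Game

/-! ### Lower bounds on the exploration-mixed weights. -/

section Weights

variable {𝓐 𝓑 : Type*} [Fintype 𝓐]

lemma softmax_nonneg (y : 𝓐 → ℝ) (a : 𝓐) : 0 ≤ softmax y a :=
  div_nonneg (Real.exp_pos _).le (Finset.sum_nonneg fun _ _ => (Real.exp_pos _).le)

lemma le_mixed {α : ℝ} (hα : α ≤ 1) (y : 𝓐 → ℝ) (a : 𝓐) :
    α / Fintype.card 𝓐 ≤ mixed α y a := by
  have := mul_nonneg (sub_nonneg.2 hα) (softmax_nonneg y a)
  unfold mixed
  rw [mul_one_div]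
  linarith

variable [DecidableEq 𝓐] [Nonempty 𝓐]

lemma mixed_pos {α : ℝ} (hα₀ : 0 < α) (hα : α ≤ 1) (y : 𝓐 → ℝ) (a : 𝓐) : 0 < mixed α y a :=
  (div_pos hα₀ (Nat.cast_pos.2 Fintype.card_pos)).trans_le (le_mixed hα y a)

lemma inv_mixed_le {α : ℝ} (hα₀ : 0 < α) (hα : α ≤ 1) (y : 𝓐 → ℝ) (a : 𝓐) :
    (mixed α y a)⁻¹ ≤ Fintype.card 𝓐 / α := by
  rw [← inv_div]
  exact inv_anti₀ (div_pos hα₀ (Nat.cast_pos.2 Fintype.card_pos)) (le_mixed hα y a)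

end Weights

/-! ### The idealized importance-weighted estimate and its concentration. -/

section Leader

variable {𝓐 𝓑 Ω : Type*} [Fintype 𝓐] [DecidableEq 𝓐] [Nonempty 𝓐] [DecidableEq 𝓑]
  {G : Game 𝓐 𝓑} {T : ℕ} {δ α η : ℝ}

/-- The importance-weighted estimate of the leader's mean reward of `a` under the best response,
where after a wrong response of the follower the reward is replaced by its target mean. -/
def estimate (G : Game 𝓐 𝓑) (br : 𝓐 → 𝓑) (α η : ℝ) (q : ℕ → Round 𝓐 𝓑) (t : ℕ) (a : 𝓐) : ℝ :=
  if actL (q t) = a then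
    (if actF (q t) = br a then clip (rewL (q t)) else G.meanL a (br a)) / exp3 α η q t a
  else 0

lemma estimate_nonneg (hα₀ : 0 < α) (hα : α ≤ 1) (br : 𝓐 → 𝓑) (q : ℕ → Round 𝓐 𝓑) (t : ℕ)
    (a : 𝓐) : 0 ≤ estimate G br α η q t a := by
  have h1 := mixed_pos hα₀ hα (score α η q (t - 1)) a
  have h2 := (G.meanL_mem_unit a (br a)).1
  have h3 := clip_nonneg (rewL (q t))
  unfold estimate exp3
  split_ifs <;> positivity

lemma estimate_le (hα₀ : 0 < α) (hα : α ≤ 1) (br : 𝓐 → 𝓑) (q : ℕ → Round 𝓐 𝓑) (t : ℕ)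
    (a : 𝓐) : estimate G br α η q t a
      ≤ if actL (q t) = a then (exp3 α η q t a)⁻¹ else 0 := by
  have h1 := mixed_pos hα₀ hα (score α η q (t - 1)) a
  have h2 := (G.meanL_mem_unit a (br a)).2
  have h3 := clip_le_one (rewL (q t))
  unfold estimate exp3
  split_ifs
  · rw [← one_div]; gcongr
  · rw [← one_div]; gcongr
  · exact le_rfl

lemma estimate_le_div (hα₀ : 0 < α) (hα : α ≤ 1) (br : 𝓐 → 𝓑) (q : ℕ → Round 𝓐 𝓑) (t : ℕ)
    (a : 𝓐) : estimate G br α η q t a ≤ Fintype.card 𝓐 / α := by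
  refine (estimate_le hα₀ hα br q t a).trans ?_
  split_ifs
  · exact inv_mixed_le hα₀ hα _ a
  · positivity

lemma abs_estimate_sub_le (hα₀ : 0 < α) (hα : α ≤ 1) (br : 𝓐 → 𝓑) (q : ℕ → Round 𝓐 𝓑) (t : ℕ)
    (a a' : 𝓐) : |estimate G br α η q t a - estimate G br α η q t a'| ≤ Fintype.card 𝓐 / α :=
  abs_sub_le_of_nonneg_of_le (estimate_nonneg hα₀ hα br q t a) (estimate_le_div hα₀ hα br q t a)
    (estimate_nonneg hα₀ hα br q t a') (estimate_le_div hα₀ hα br q t a')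

variable [MeasurableSpace 𝓐] [DiscreteMeasurableSpace 𝓐] [MeasurableSpace 𝓑]
  [DiscreteMeasurableSpace 𝓑] [mΩ : MeasurableSpace Ω] {P : Measure Ω} [IsProbabilityMeasure P]
  {h : ℕ → Ω → Round 𝓐 𝓑}

lemma measurable_estimate (G : Game 𝓐 𝓑) (br : 𝓐 → 𝓑) (α η : ℝ) (h : ℕ → Ω → Round 𝓐 𝓑)
    {t : ℕ} (ht : 1 ≤ t) (a : 𝓐) :
    Measurable[past h (t + 1)] (fun ω => estimate G br α η (fun τ => h τ ω) t a) := by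
  have hx := (measurable_exp3 h α η ht a).mono (past_mono h t.le_succ) le_rfl
  have hq := measurable_past (h := h) ht t.lt_succ_self
  let _ := past h (t + 1)
  refine Measurable.ite ((measurable_actL.comp hq) (measurableSet_singleton a)) ?_ measurable_const
  refine Measurable.div (Measurable.ite ?_ ?_ measurable_const) hx
  · exact (measurable_actF.comp hq) (measurableSet_singleton (br a))
  · exact measurable_clip.comp (measurable_rewL.comp hq)

/-- Paying the target mean after a wrong answer makes the mean reward, given the past and both
actions, equal to `G.meanL a (br a)` whenever a is played; the importance weight then cancels the
probability of playing a. No assumption on the follower is needed. -/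
lemma IsEXP3UCBRun.integral_mul_estimate (run : IsEXP3UCBRun G T δ α η P h) (hα₀ : 0 < α)
    (hα : α ≤ 1) (br : 𝓐 → 𝓑) {t : ℕ} (ht : t ∈ Set.Icc 1 T) (a : 𝓐) {g : Ω → ℝ}
    (hg : Measurable[past h t] g) {C : ℝ} (hgC : ∀ ω, |g ω| ≤ C) :
    ∫ ω, g ω * estimate G br α η (fun τ => h τ ω) t a ∂P
      = G.meanL a (br a) * ∫ ω, g ω ∂P := by
  set g' : Ω → ℝ := fun ω => g ω * (exp3 α η (fun τ => h τ ω) t a)⁻¹ with hg'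
  have hg'm : Measurable[past h t] g' := hg.mul (measurable_exp3 h α η ht.1 a).inv
  have hpos : ∀ ω, 0 < exp3 α η (fun τ => h τ ω) t a := fun ω => mixed_pos hα₀ hα _ a
  have hg'C : ∀ ω, |g' ω| ≤ C * (Fintype.card 𝓐 / α) := fun ω => by
    rw [abs_mul, abs_of_pos (inv_pos.2 (hpos ω))]
    exact mul_le_mul (hgC ω) (inv_mixed_le hα₀ hα _ a) (inv_pos.2 (hpos ω)).le
      ((abs_nonneg _).trans (hgC ω))
  have hle := run.past_le (ht.2.trans T.le_succ)
  have hlePA := run.pastAndActions_le ht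
  have hcm : Measurable fun r : ℝ × ℝ => clip r.1 := measurable_clip.comp measurable_fst
  have hcb : ∀ r : ℝ × ℝ, |clip r.1| ≤ 1 := fun r => by
    rw [abs_of_nonneg (clip_nonneg _)]; exact clip_le_one _
  have e1 := run.integral_mul_reward ht a (br a)
    (hg'm.mono (past_le_pastAndActions h t) le_rfl) hg'C hcm hcb
  have e2 := run.integral_mul_actL ht a hg'm hg'C
  rw [G.integral_clip_fst] at e1
  set D := {ω | actL (h t ω) = a} with hD
  set E := {ω | actL (h t ω) = a ∧ actF (h t ω) = br a} with hE
  have hDm : MeasurableSet D := hlePA _ (measurableSet_actL h t a)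
  have hEm : MeasurableSet E := hlePA _ (measurableSet_actions h t a (br a))
  have hgm : Measurable g' := hg'm.mono hle le_rfl
  have hone : ∀ S : Set Ω, ∀ ω, |S.indicator (fun _ => (1 : ℝ)) ω| ≤ 1 := fun S ω => by
    by_cases hω : ω ∈ S <;> simp [hω]
  have hbd : ∀ f : Ω → ℝ, (∀ ω, |f ω| ≤ 1) → Measurable f →
      Integrable (fun ω => g' ω * f ω) P := fun f hf hfm =>
    integrable_of_abs_le (hgm.mul hfm) (C := C * (Fintype.card 𝓐 / α) * 1) fun ω => by
      rw [abs_mul]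
      exact mul_le_mul (hg'C ω) (hf ω) (abs_nonneg _) ((abs_nonneg _).trans (hg'C ω))
  have i1 := hbd _ (hone D) (measurable_const.indicator hDm)
  have i2 := hbd _ (hone E) (measurable_const.indicator hEm)
  have i3 := hbd (E.indicator fun ω => clip (rewL (h t ω))) (fun ω => by
      by_cases hω : ω ∈ E
      · simpa [hω] using hcb (rewL (h t ω), 0)
      · simp [hω])
    ((hcm.comp (run.measurable_rewards ht)).indicator hEm)
  -- Importance-weighted constant on `D`, plus a reward noise on `E` whose integral against `g'`
  -- vanishes.
  have hdec : ∀ ω, g ω * estimate G br α η (fun τ => h τ ω) t a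
      = G.meanL a (br a) * (g' ω * D.indicator (fun _ => 1) ω)
        + (g' ω * E.indicator (fun ω => clip (rewL (h t ω))) ω
          - G.meanL a (br a) * (g' ω * E.indicator (fun _ => 1) ω)) := fun ω => by
    by_cases h1 : actL (h t ω) = a
    · by_cases h2 : actF (h t ω) = br a
      · simp [estimate, D, E, h1, h2, g', div_eq_mul_inv]; ring
      · simp [estimate, D, E, h1, h2, g', div_eq_mul_inv]; ring
    · simp [estimate, D, E, h1]
  have i4 : Integrable (fun ω => g' ω * E.indicator (fun ω => clip (rewL (h t ω))) ω
      - G.meanL a (br a) * (g' ω * E.indicator (fun _ => 1) ω)) P := i3.sub (i2.const_mul _)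
  simp_rw [hdec]
  rw [integral_add (i1.const_mul _) i4,
    integral_sub i3 (i2.const_mul _), integral_const_mul, integral_const_mul, e1, e2, sub_self,
    add_zero]
  congr 2
  ext ω
  simp [g', (hpos ω).ne']

/-- The square is at most the indicator of playing a divided by the squared weight. Integrating out
the action cancels one factor of the weight, and the other is at least α/A. -/
lemma IsEXP3UCBRun.integral_mul_estimate_sq_le (run : IsEXP3UCBRun G T δ α η P h) (hα₀ : 0 < α)
    (hα : α ≤ 1) (br : 𝓐 → 𝓑) {t : ℕ} (ht : t ∈ Set.Icc 1 T) (a : 𝓐) {g : Ω → ℝ}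
    (hg : Measurable[past h t] g) (hg0 : ∀ ω, 0 ≤ g ω) {C : ℝ} (hgC : ∀ ω, |g ω| ≤ C) :
    ∫ ω, g ω * estimate G br α η (fun τ => h τ ω) t a ^ 2 ∂P
      ≤ Fintype.card 𝓐 / α * ∫ ω, g ω ∂P := by
  set R : ℝ := Fintype.card 𝓐 / α with hR
  have hR0 : 0 ≤ R := by positivity
  have hle := run.past_le (ht.2.trans T.le_succ)
  have hpos : ∀ ω, 0 < exp3 α η (fun τ => h τ ω) t a := fun ω => mixed_pos hα₀ hα _ a
  set x : Ω → ℝ := fun ω => exp3 α η (fun τ => h τ ω) t a with hx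
  have hxm := measurable_exp3 h α η ht.1 a
  have hxR : ∀ ω, (x ω)⁻¹ ≤ R := fun ω => inv_mixed_le hα₀ hα _ a
  set g' : Ω → ℝ := fun ω => g ω * (x ω)⁻¹ * (x ω)⁻¹ with hg'
  have hg'm : Measurable[past h t] g' := (hg.mul hxm.inv).mul hxm.inv
  have hg'C : ∀ ω, |g' ω| ≤ C * R * R := fun ω => by
    have hi := (inv_pos.2 (hpos ω)).le
    have hC0 := (abs_nonneg _).trans (hgC ω)
    rw [abs_mul, abs_mul, abs_of_nonneg hi]
    exact mul_le_mul (mul_le_mul (hgC ω) (hxR ω) hi hC0) (hxR ω) hi (by positivity)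
  have e2 := run.integral_mul_actL ht a hg'm hg'C
  set D := {ω | actL (h t ω) = a} with hD
  have hDm : MeasurableSet D := run.pastAndActions_le ht _ (measurableSet_actL h t a)
  have hgm : Measurable g := hg.mono hle le_rfl
  have hWm := (measurable_estimate G br α η h ht.1 a).mono
    (run.past_le (Nat.succ_le_succ ht.2)) le_rfl
  have hgi : Integrable g P := integrable_of_abs_le hgm hgC
  calc _ ≤ ∫ ω, g' ω * D.indicator (fun _ => 1) ω ∂P := by
        refine integral_mono
          (integrable_of_abs_le (hgm.mul (hWm.pow_const 2)) (C := C * R ^ 2) fun ω => ?_)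
          (integrable_of_abs_le ((hg'm.mono hle le_rfl).mul (measurable_const.indicator hDm))
            (C := C * R * R * 1) fun ω => ?_) fun ω => ?_
        · have hC0 := (abs_nonneg _).trans (hgC ω)
          rw [abs_mul, abs_of_nonneg (sq_nonneg (estimate G br α η (fun τ => h τ ω) t a))]
          have := estimate_le_div (G := G) (η := η) hα₀ hα br (fun τ => h τ ω) t a
          exact mul_le_mul (hgC ω) (pow_le_pow_left₀ (estimate_nonneg hα₀ hα br _ t a) this 2)
            (sq_nonneg _) hC0
        · rw [abs_mul]
          refine mul_le_mul (hg'C ω) ?_ (abs_nonneg _) ((abs_nonneg _).trans (hg'C ω))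
          by_cases hω : ω ∈ D <;> simp [hω]
        · have h1 := estimate_le (G := G) (η := η) hα₀ hα br (fun τ => h τ ω) t a
          have h0 := estimate_nonneg (G := G) (η := η) hα₀ hα br (fun τ => h τ ω) t a
          by_cases hω : actL (h t ω) = a
          · simp only [hω, if_true] at h1
            have := pow_le_pow_left₀ h0 h1 2
            simp only [D, Set.mem_ofPred_eq, hω, Set.indicator_of_mem, mul_one, g', mul_assoc]
            rw [← sq]
            exact mul_le_mul_of_nonneg_left this (hg0 ω)
          · simp [estimate, hω, D]
    _ = ∫ ω, g ω * (x ω)⁻¹ ∂P := by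
        rw [e2]
        congr 1
        ext ω
        have := (hpos ω).ne'
        simp only [g', x]
        field_simp
    _ ≤ ∫ ω, R * g ω ∂P := by
        refine integral_mono (integrable_of_abs_le (hgm.mul (hxm.mono hle le_rfl).inv)
          (C := C * R) fun ω => ?_) (hgi.const_mul R) fun ω => ?_
        · have hi := (inv_pos.2 (hpos ω)).le
          rw [abs_mul, abs_of_nonneg hi]
          exact mul_le_mul (hgC ω) (hxR ω) hi ((abs_nonneg _).trans (hgC ω))
        · simp only [mul_comm R]
          exact mul_le_mul_of_nonneg_left (hxR ω) (hg0 ω)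
    _ = _ := integral_const_mul _ _

lemma estimate_mul_estimate (br : 𝓐 → 𝓑) (q : ℕ → Round 𝓐 𝓑) (t : ℕ) {a a' : 𝓐} (ha : a ≠ a') :
    estimate G br α η q t a * estimate G br α η q t a' = 0 := by
  unfold estimate
  by_cases h1 : actL (q t) = a
  · simp [h1, ha]
  · simp [h1]

/-- Bernstein-type bound for the difference of two cumulative estimates. -/
lemma IsEXP3UCBRun.measureReal_sum_estimate_le (run : IsEXP3UCBRun G T δ α η P h) (hα₀ : 0 < α)
    (hα : α ≤ 1) (br : 𝓐 → 𝓑) {a a' : 𝓐} (ha : a ≠ a') (hT : 1 ≤ T) {lam : ℝ} (hlam : 0 < lam)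
    (hlam1 : lam * (Fintype.card 𝓐 / α) ≤ 1) (L : ℝ) :
    P.real {ω | (G.meanL a (br a) - G.meanL a' (br a')) * (T - 1)
        + 3 / 4 * lam * (2 * (Fintype.card 𝓐 / α)) * T + L / lam
      ≤ ∑ τ ∈ Finset.Ico 1 T, (estimate G br α η (fun τ => h τ ω) τ a
          - estimate G br α η (fun τ => h τ ω) τ a')} ≤ Real.exp (-L) := by
  set R : ℝ := Fintype.card 𝓐 / α with hR
  have hR0 : 0 ≤ R := by positivity
  set D := G.meanL a (br a) - G.meanL a' (br a') with hD
  set Z : ℕ → Ω → ℝ := fun t ω => estimate G br α η (fun τ => h τ ω) t a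
          - estimate G br α η (fun τ => h τ ω) t a' with hZ
  -- Bound on the conditional cumulant of `lam * Z`: drift plus 3/4 of the second moment, where each
  -- of the two actions contributes at most `R`.
  set κ : ℝ := lam * D + 3 / 4 * lam ^ 2 * (2 * R) with hκ
  have hZR : ∀ t ω, |Z t ω| ≤ R := fun t ω => abs_estimate_sub_le hα₀ hα br _ t a a'
  have hlZ : ∀ t ω, |lam * Z t ω| ≤ 1 := fun t ω => by
    rw [abs_mul, abs_of_pos hlam]
    exact (mul_le_mul_of_nonneg_left (hZR t ω) hlam.le).trans hlam1
  have hZm : ∀ t, 1 ≤ t → Measurable[past h (t + 1)] (Z t) := fun t ht =>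
    (measurable_estimate G br α η h ht a).sub (measurable_estimate G br α η h ht a')
  have main := measureReal_le_sum_le_exp_neg (P := P) (𝓕 := past h) (T := T)
    (X := fun t ω => lam * Z t ω - κ) (C := 1 + |κ|)
    (fun s t hst => past_mono h hst) (fun t ht => run.past_le (ht.trans T.le_succ))
    (fun t ht => ((hZm t ht.1).const_mul lam).sub_const κ)
    (fun t ω => (abs_sub _ _).trans (add_le_add_left (hlZ t ω) _)) ?_ hT le_rfl L
  · refine (measureReal_mono ?_ (measure_ne_top _ _)).trans main
    intro ω hω
    simp only [Set.mem_ofPred_eq] at hω ⊢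
    rw [Finset.sum_sub_distrib, ← Finset.mul_sum, Finset.sum_const, Nat.card_Ico, nsmul_eq_mul,
      Nat.cast_sub hT, Nat.cast_one]
    have h1 := mul_le_mul_of_nonneg_left hω hlam.le
    have h2 : lam * (D * (T - 1) + 3 / 4 * lam * (2 * R) * T + L / lam)
        = (T - 1) * κ + 3 / 4 * lam ^ 2 * (2 * R) + L := by
      rw [hκ]; field_simp; ring
    -- Only T-1 rounds are summed, while the threshold pays the variance term T times; this is the
    -- surplus.
    have h3 : 0 ≤ 3 / 4 * lam ^ 2 * (2 * R) := by positivity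
    rw [h2] at h1
    linarith
  · intro t ht g hg hg0 K hgK
    have ht' : t ∈ Set.Icc 1 T := ⟨ht.1, ht.2.le⟩
    have hle := run.past_le (ht'.2.trans T.le_succ)
    have hle' := run.past_le (Nat.succ_le_succ ht'.2)
    have hgm : Measurable g := hg.mono hle le_rfl
    have hgi : Integrable g P := integrable_of_abs_le hgm hgK
    have hWm : ∀ a, Measurable fun ω => estimate G br α η (fun τ => h τ ω) t a := fun a =>
      (measurable_estimate G br α η h ht.1 a).mono hle' le_rfl
    have hWi : ∀ a, Integrable (fun ω => g ω * estimate G br α η (fun τ => h τ ω) t a) P := by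
      refine fun a => hgi.mul_bdd (c := R) (hWm a).aestronglyMeasurable
        (Filter.Eventually.of_forall fun ω => ?_)
      rw [Real.norm_eq_abs, abs_of_nonneg (estimate_nonneg hα₀ hα br _ t a)]
      exact estimate_le_div hα₀ hα br _ t a
    have hWi2 : ∀ a, Integrable (fun ω => g ω * estimate G br α η (fun τ => h τ ω) t a ^ 2) P := by
      refine fun a => hgi.mul_bdd (c := R ^ 2) ((hWm a).pow_const 2).aestronglyMeasurable
        (Filter.Eventually.of_forall fun ω => ?_)
      rw [Real.norm_eq_abs, abs_of_nonneg (sq_nonneg _)]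
      exact pow_le_pow_left₀ (estimate_nonneg hα₀ hα br _ t a) (estimate_le_div hα₀ hα br _ t a) 2
    have key : ∫ ω, g ω * Real.exp (lam * Z t ω) ∂P ≤ Real.exp κ * ∫ ω, g ω ∂P := by
      calc _ ≤ ∫ ω, (g ω + (lam * (g ω * estimate G br α η (fun τ => h τ ω) t a)
                - lam * (g ω * estimate G br α η (fun τ => h τ ω) t a'))
              + (3 / 4 * lam ^ 2 * (g ω * estimate G br α η (fun τ => h τ ω) t a ^ 2)
                + 3 / 4 * lam ^ 2 * (g ω * estimate G br α η (fun τ => h τ ω) t a' ^ 2))) ∂P := by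
            refine integral_mono (hgi.mul_bdd (c := Real.exp 1) ?_ ?_)
              ((hgi.add (((hWi a).const_mul _).sub ((hWi a').const_mul _))).add
                (((hWi2 a).const_mul _).add ((hWi2 a').const_mul _))) fun ω => ?_
            · exact (Real.measurable_exp.comp (((hWm a).sub (hWm a')).const_mul
                lam)).aestronglyMeasurable
            · refine Filter.Eventually.of_forall fun ω => ?_
              rw [Real.norm_eq_abs, abs_of_pos (Real.exp_pos _)]
              exact Real.exp_le_exp.2 ((le_abs_self _).trans (hlZ t ω))
            · have h1 := mul_le_mul_of_nonneg_left (exp_le_one_add_add_sq (hlZ t ω)) (hg0 ω)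
              refine h1.trans (le_of_eq ?_)
              -- Only one action is played per round, so the cross term of the square vanishes.
              have h2 := estimate_mul_estimate (G := G) (α := α) (η := η) br (fun τ => h τ ω) t ha
              simp only [Z]
              linear_combination (-(3 / 2) * lam ^ 2 * g ω) * h2
        _ = ∫ ω, g ω ∂P + (lam * (G.meanL a (br a) * ∫ ω, g ω ∂P)
              - lam * (G.meanL a' (br a') * ∫ ω, g ω ∂P))
              + (3 / 4 * lam ^ 2 * ∫ ω, g ω * estimate G br α η (fun τ => h τ ω) t a ^ 2 ∂P
              + 3 / 4 * lam ^ 2 * ∫ ω, g ω * estimate G br α η (fun τ => h τ ω) t a' ^ 2 ∂P) := by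
            have j1 : Integrable (fun ω => lam * (g ω * estimate G br α η (fun τ => h τ ω) t a)
                - lam * (g ω * estimate G br α η (fun τ => h τ ω) t a')) P :=
              ((hWi a).const_mul _).sub ((hWi a').const_mul _)
            have j2 : Integrable (fun ω =>
                3 / 4 * lam ^ 2 * (g ω * estimate G br α η (fun τ => h τ ω) t a ^ 2)
                + 3 / 4 * lam ^ 2 * (g ω * estimate G br α η (fun τ => h τ ω) t a' ^ 2)) P :=
              ((hWi2 a).const_mul _).add ((hWi2 a').const_mul _)
            have j3 : Integrable (fun ω => g ω
                + (lam * (g ω * estimate G br α η (fun τ => h τ ω) t a)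
                - lam * (g ω * estimate G br α η (fun τ => h τ ω) t a'))) P := hgi.add j1
            rw [integral_add j3 j2, integral_add hgi j1,
              integral_sub ((hWi a).const_mul _) ((hWi a').const_mul _),
              integral_add ((hWi2 a).const_mul _) ((hWi2 a').const_mul _)]
            simp only [integral_const_mul]
            rw [run.integral_mul_estimate hα₀ hα br ht' a hg hgK,
              run.integral_mul_estimate hα₀ hα br ht' a' hg hgK]
        _ ≤ (1 + κ) * ∫ ω, g ω ∂P := by
            have h1 := run.integral_mul_estimate_sq_le hα₀ hα br ht' a hg hg0 hgK
            have h2 := run.integral_mul_estimate_sq_le hα₀ hα br ht' a' hg hg0 hgK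
            have h3 := mul_le_mul_of_nonneg_left (add_le_add h1 h2)
              (by positivity : 0 ≤ 3 / 4 * lam ^ 2)
            rw [hκ, hD]
            linarith
        _ ≤ _ := mul_le_mul_of_nonneg_right (by linarith [Real.add_one_le_exp κ])
            (integral_nonneg hg0)
    calc _ = Real.exp (-κ) * ∫ ω, g ω * Real.exp (lam * Z t ω) ∂P := by
          rw [← integral_const_mul]
          congr 1
          ext ω
          rw [sub_eq_add_neg, Real.exp_add]
          ring
      _ ≤ Real.exp (-κ) * (Real.exp κ * ∫ ω, g ω ∂P) :=
          mul_le_mul_of_nonneg_left key (Real.exp_pos _).le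
      _ = _ := by rw [← mul_assoc, ← Real.exp_add]; simp

end Leader

/-! ### Gaps of the game and Hoeffding's lemma for its rewards. -/

namespace Game

variable {𝓐 𝓑 : Type*} [Fintype 𝓐] [Fintype 𝓑] (G : Game 𝓐 𝓑) {br : 𝓐 → 𝓑} {ase : 𝓐}

lemma gapF_le {a : 𝓐} {b : 𝓑} (hb : b ≠ br a) :
    G.gapF br ≤ G.meanF a (br a) - G.meanF a b :=
  ciInf_le (f := fun p : {p : 𝓐 × 𝓑 // p.2 ≠ br p.1} =>
    G.meanF p.1.1 (br p.1.1) - G.meanF p.1.1 p.1.2) (Set.finite_range _).bddBelow ⟨(a, b), hb⟩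

lemma gapL_le {a : 𝓐} (ha : a ≠ ase) :
    G.gapL br ase ≤ G.meanL ase (br ase) - G.meanL a (br a) :=
  ciInf_le (f := fun a : {a : 𝓐 // a ≠ ase} =>
    G.meanL ase (br ase) - G.meanL a.1 (br a.1)) (Set.finite_range _).bddBelow ⟨a, ha⟩

lemma gapF_pos [Nonempty 𝓐] [Nontrivial 𝓑] (hbr : G.IsUniqueBestResponse br) :
    0 < G.gapF br := by
  obtain ⟨a⟩ := ‹Nonempty 𝓐›
  obtain ⟨b, hb⟩ := exists_ne (br a)
  have : Nonempty {p : 𝓐 × 𝓑 // p.2 ≠ br p.1} := ⟨⟨(a, b), hb⟩⟩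
  obtain ⟨⟨⟨a, b⟩, hp⟩, h⟩ := exists_eq_ciInf_of_finite
    (f := fun p : {p : 𝓐 × 𝓑 // p.2 ≠ br p.1} =>
      G.meanF p.1.1 (br p.1.1) - G.meanF p.1.1 p.1.2)
  unfold gapF
  rw [← h]
  by_contra hle
  have hmax := (hbr a (br a)).2 rfl
  exact hp ((hbr a b).1 fun b' => (hmax b').trans (by simp at hle; linarith))

lemma gapL_pos [Nontrivial 𝓐] (hse : G.IsUniqueStackelberg br ase) : 0 < G.gapL br ase := by
  obtain ⟨a, ha⟩ := exists_ne ase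
  have : Nonempty {a : 𝓐 // a ≠ ase} := ⟨⟨a, ha⟩⟩
  obtain ⟨⟨a, hp⟩, h⟩ := exists_eq_ciInf_of_finite
    (f := fun a : {a : 𝓐 // a ≠ ase} => G.meanL ase (br ase) - G.meanL a.1 (br a.1))
  unfold gapL
  rw [← h]
  by_contra hle
  have hmax := (hse ase).2 rfl
  exact hp ((hse a).1 fun a' => (hmax a').trans (by simp at hle; linarith))

lemma gapF_le_one [Nonempty 𝓐] [Nontrivial 𝓑] : G.gapF br ≤ 1 := by
  obtain ⟨a⟩ := ‹Nonempty 𝓐›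
  obtain ⟨b, hb⟩ := exists_ne (br a)
  linarith [G.gapF_le hb, (G.meanF_mem_unit a (br a)).2, (G.meanF_mem_unit a b).1]

lemma gapL_le_one [Nontrivial 𝓐] : G.gapL br ase ≤ 1 := by
  obtain ⟨a, ha⟩ := exists_ne ase
  linarith [G.gapL_le (br := br) ha, (G.meanL_mem_unit ase (br ase)).2,
    (G.meanL_mem_unit a (br a)).1]

lemma integral_exp_clip_le (a : 𝓐) (b : 𝓑) (lam : ℝ) :
    ∫ r, Real.exp (lam * (clip r.2 - G.meanF a b)) ∂(G.reward a b) ≤ Real.exp (lam ^ 2 / 8) := by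
  have := G.isProbabilityMeasure a b
  have h := (hasSubgaussianMGF_of_mem_Icc (μ := G.reward a b) (X := fun r => clip r.2)
    (a := 0) (b := 1) (measurable_clip.comp measurable_snd).aemeasurable
    (Filter.Eventually.of_forall fun r => ⟨clip_nonneg _, clip_le_one _⟩)).mgf_le lam
  simp only [G.integral_clip_snd, mgf] at h
  refine h.trans (le_of_eq ?_)
  congr 1
  simp
  ring

end Game

/-! ### Deterministic count of wrong answers of the UCB follower. -/

section Counting

variable {𝓐 𝓑 : Type*} [DecidableEq 𝓐] [DecidableEq 𝓑]

/-- How often `(a,b)` was played in rounds `1, …, t-1`. -/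
def plays (q : ℕ → Round 𝓐 𝓑) (t : ℕ) (a : 𝓐) (b : 𝓑) : ℕ :=
  ((Finset.Ico 1 t).filter fun τ => actL (q τ) = a ∧ actF (q τ) = b).card

lemma sum_ite_eq_plays (q : ℕ → Round 𝓐 𝓑) (t : ℕ) (a : 𝓐) (b : 𝓑) :
    (∑ τ ∈ Finset.Ico 1 t, if actL (q τ) = a ∧ actF (q τ) = b then (1 : ℝ) else 0)
      = plays q t a b := by
  rw [Finset.sum_boole, plays]

lemma plays_le (q : ℕ → Round 𝓐 𝓑) (t : ℕ) (a : 𝓐) (b : 𝓑) : plays q t a b ≤ t - 1 :=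
  (Finset.card_filter_le _ _).trans (by simp)

lemma visits_eq (q : ℕ → Round 𝓐 𝓑) (t : ℕ) (a : 𝓐) (b : 𝓑) :
    visits q t a b = max 1 (plays q t a b : ℝ) := by
  rw [visits, sum_ite_eq_plays]

lemma plays_succ (q : ℕ → Round 𝓐 𝓑) {t : ℕ} (ht : 1 ≤ t) (a : 𝓐) (b : 𝓑) :
    (plays q (t + 1) a b : ℝ)
      = plays q t a b + if actL (q t) = a ∧ actF (q t) = b then 1 else 0 := by
  rw [← sum_ite_eq_plays, ← sum_ite_eq_plays, Finset.sum_Ico_succ_top ht]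

/-- The follower's total reward from `(a,b)` in rounds `1, …, t-1`. -/
def totalF (q : ℕ → Round 𝓐 𝓑) (t : ℕ) (a : 𝓐) (b : 𝓑) : ℝ :=
  ∑ τ ∈ Finset.Ico 1 t, if actL (q τ) = a ∧ actF (q τ) = b then rewF (q τ) else 0

/-- All empirical means of the follower are within the UCB confidence width. -/
def Concentrated (G : Game 𝓐 𝓑) (T : ℕ) (δ : ℝ) (q : ℕ → Round 𝓐 𝓑) : Prop :=
  ∀ t ∈ Set.Icc 1 T, ∀ a b, |totalF q t a b - G.meanF a b * plays q t a b|
    ≤ Real.sqrt (2 * Real.log (T / δ) * plays q t a b)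

variable {G : Game 𝓐 𝓑} {T : ℕ} {δ : ℝ} {q : ℕ → Round 𝓐 𝓑}

lemma Concentrated.abs_empF_sub_le (hq : Concentrated G T δ q) {t : ℕ} (ht : t ∈ Set.Icc 1 T)
    {a : 𝓐} {b : 𝓑} (hn : 1 ≤ plays q t a b) :
    |empF q t a b - G.meanF a b| ≤ Real.sqrt (2 * Real.log (T / δ) / visits q t a b) := by
  have h1 := hq t ht a b
  have hn' : (1 : ℝ) ≤ plays q t a b := by exact_mod_cast hn
  have hv : visits q t a b = plays q t a b := by rw [visits_eq, max_eq_right hn']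
  have he : empF q t a b = totalF q t a b / plays q t a b := by
    rw [empF, hv, totalF]; ring
  rw [hv, he]
  set n : ℝ := (plays q t a b : ℝ)
  have hn0 : 0 < n := by linarith
  have e1 : totalF q t a b / n - G.meanF a b = (totalF q t a b - G.meanF a b * n) / n := by
    field_simp
  have e2 : Real.sqrt (2 * Real.log (T / δ) / n) = Real.sqrt (2 * Real.log (T / δ) * n) / n := by
    rw [eq_div_iff hn0.ne']
    nth_rewrite 2 [← Real.sqrt_sq hn0.le]
    rw [← Real.sqrt_mul' _ (sq_nonneg n)]
    congr 1
    field_simp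
  rw [e1, e2, abs_div, abs_of_pos hn0]
  gcongr

/-- For a pair never played, the default count 1 and empirical mean 0 leave only the width, which is
at least 1 because the logarithm is; otherwise this is concentration. -/
lemma Concentrated.meanF_le_ucbF (hq : Concentrated G T δ q) (hl : 1 ≤ Real.log (T / δ)) {t : ℕ}
    (ht : t ∈ Set.Icc 1 T) (a : 𝓐) (b : 𝓑) : G.meanF a b ≤ ucbF T δ q t a b := by
  rcases Nat.eq_zero_or_pos (plays q t a b) with h0 | hn
  · have h2 : empF q t a b = 0 := by
      have : ∀ τ ∈ Finset.Ico 1 t, ¬ (actL (q τ) = a ∧ actF (q τ) = b) := by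
        rw [plays, Finset.card_eq_zero, Finset.filter_eq_empty_iff] at h0
        exact fun τ hτ => h0 hτ
      rw [empF, Finset.sum_eq_zero fun τ hτ => if_neg (this τ hτ), mul_zero]
    have h3 : visits q t a b = 1 := by rw [visits_eq, h0]; simp
    rw [ucbF, h2, h3, div_one, zero_add]
    refine (G.meanF_mem_unit a b).2.trans (Real.one_le_sqrt.2 (by linarith))
  · have := abs_le.1 (hq.abs_empF_sub_le ht hn)
    rw [ucbF]
    linarith [this.1]

/-- When b is preferred to the best response, its upper bound exceeds the best mean, so the gap is
at most twice the width of b. This caps the count before that play by `8 * Real.log (T / δ) / G.gapF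
br ^ 2`; the play itself is the extra 1. -/
lemma Concentrated.plays_le [Fintype 𝓐] [Fintype 𝓑] {br : 𝓐 → 𝓑} (hgap : 0 < G.gapF br)
    (hq : Concentrated G T δ q) (hl : 1 ≤ Real.log (T / δ))
    (hfoll : ∀ t ∈ Set.Icc 1 T, ∀ b,
      ucbF T δ q t (actL (q t)) b ≤ ucbF T δ q t (actL (q t)) (actF (q t)))
    {a : 𝓐} {b : 𝓑} (hb : b ≠ br a) {t : ℕ} (ht : t ∈ Set.Icc 1 T) :
    (plays q t a b : ℝ) ≤ 8 * Real.log (T / δ) / G.gapF br ^ 2 + 1 := by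
  have hK : 0 ≤ 8 * Real.log (T / δ) / G.gapF br ^ 2 := by positivity
  obtain ⟨ht1, htT⟩ := ht
  induction t, ht1 using Nat.le_induction with
  | base => simp [plays]; linarith
  | succ t ht ih =>
    have htT' : t ≤ T := by omega
    rw [plays_succ q ht]
    split_ifs with hab
    · rcases Nat.eq_zero_or_pos (plays q t a b) with h0 | hn
      · rw [h0]; simp; linarith
      · have h1 := hfoll t ⟨ht, htT'⟩ (br a)
        rw [hab.1, hab.2] at h1
        have h2 := hq.meanF_le_ucbF hl ⟨ht, htT'⟩ a (br a)
        have h3 := abs_le.1 (hq.abs_empF_sub_le ⟨ht, htT'⟩ hn)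
        have h4 := G.gapF_le hb
        have hn' : (1 : ℝ) ≤ plays q t a b := by exact_mod_cast hn
        have hv : visits q t a b = plays q t a b := by rw [visits_eq, max_eq_right hn']
        have h5 : G.gapF br ≤ 2 * Real.sqrt (2 * Real.log (T / δ) / visits q t a b) := by
          rw [ucbF, ucbF] at h1
          rw [ucbF] at h2
          linarith [h3.2]
        rw [hv] at h5
        have h6 := pow_le_pow_left₀ hgap.le h5 2
        rw [mul_pow, Real.sq_sqrt (by positivity)] at h6
        have hn0 : (0 : ℝ) < plays q t a b := by linarith
        have h7 : (plays q t a b : ℝ) ≤ 8 * Real.log (T / δ) / G.gapF br ^ 2 := by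
          rw [le_div_iff₀ (by positivity)]
          rw [← mul_div_assoc, le_div_iff₀ hn0] at h6
          linarith
        linarith
    · rw [add_zero]; exact ih htT'

/-- How often the follower failed to best-respond to `a` in rounds `1, …, t-1`. -/
def wrongPlays (br : 𝓐 → 𝓑) (q : ℕ → Round 𝓐 𝓑) (t : ℕ) (a : 𝓐) : ℝ :=
  ∑ τ ∈ Finset.Ico 1 t, if actL (q τ) = a ∧ actF (q τ) ≠ br a then 1 else 0

lemma Concentrated.wrongPlays_le [Fintype 𝓐] [Fintype 𝓑] {br : 𝓐 → 𝓑} (hgap : 0 < G.gapF br)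
    (hq : Concentrated G T δ q) (hl : 1 ≤ Real.log (T / δ))
    (hfoll : ∀ t ∈ Set.Icc 1 T, ∀ b,
      ucbF T δ q t (actL (q t)) b ≤ ucbF T δ q t (actL (q t)) (actF (q t)))
    (a : 𝓐) {t : ℕ} (ht : t ∈ Set.Icc 1 T) :
    wrongPlays br q t a ≤ Fintype.card 𝓑 * (8 * Real.log (T / δ) / G.gapF br ^ 2 + 1) := by
  have hK : 0 ≤ 8 * Real.log (T / δ) / G.gapF br ^ 2 := by positivity
  have h1 : wrongPlays br q t a = ∑ b, if b ≠ br a then (plays q t a b : ℝ) else 0 := by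
    simp_rw [← sum_ite_eq_plays, ← Finset.sum_filter]
    rw [Finset.sum_filter, wrongPlays]
    simp_rw [Finset.sum_filter]
    have : ∀ b, (if b ≠ br a then
        ∑ τ ∈ Finset.Ico 1 t, (if actL (q τ) = a ∧ actF (q τ) = b then (1 : ℝ) else 0) else 0)
        = ∑ τ ∈ Finset.Ico 1 t, if b ≠ br a then
          (if actL (q τ) = a ∧ actF (q τ) = b then (1 : ℝ) else 0) else 0 := fun b => by
      split_ifs <;> simp
    simp_rw [this]
    rw [Finset.sum_comm]
    refine Finset.sum_congr rfl fun τ _ => ?_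
    rw [Finset.sum_eq_single (actF (q τ))]
    · by_cases h1 : actL (q τ) = a <;> by_cases h2 : actF (q τ) = br a <;> simp [h1, h2]
    · intro b _ hb
      simp [hb.symm]
    · simp
  rw [h1, ← nsmul_eq_mul, ← Finset.card_univ, ← Finset.sum_const]
  refine Finset.sum_le_sum fun b _ => ?_
  split_ifs with hb
  · exact hq.plays_le hgap hl hfoll hb ht
  · linarith

end Counting

/-! ### From scores to the leader's weights. -/

section Scores

variable {𝓐 𝓑 : Type*} [Fintype 𝓐] [DecidableEq 𝓐] [Nonempty 𝓐] [DecidableEq 𝓑]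
  {G : Game 𝓐 𝓑} {α η : ℝ} {q : ℕ → Round 𝓐 𝓑}

lemma score_eq_sum (α η : ℝ) (q : ℕ → Round 𝓐 𝓑) (t : ℕ) (a : 𝓐) :
    score α η q t a = η * ∑ τ ∈ Finset.Ico 1 (t + 1),
      if actL (q τ) = a then rewL (q τ) / exp3 α η q τ a else 0 := by
  induction t with
  | zero => simp [score]
  | succ t ih => rw [Finset.sum_Ico_succ_top (by omega), mul_add, ← ih]; rfl

lemma abs_sub_estimate_le (hα₀ : 0 < α) (hα : α ≤ 1) (br : 𝓐 → 𝓑) {t : ℕ}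
    (hr : rewL (q t) ∈ Set.Icc (0 : ℝ) 1) (a : 𝓐) :
    |(if actL (q t) = a then rewL (q t) / exp3 α η q t a else 0) - estimate G br α η q t a|
      ≤ Fintype.card 𝓐 / α * if actL (q t) = a ∧ actF (q t) ≠ br a then 1 else 0 := by
  unfold estimate
  by_cases h1 : actL (q t) = a
  · by_cases h2 : actF (q t) = br a
    · simp [h1, h2, clip_of_mem hr]
    · simp only [h1, h2, if_true, if_false, ne_eq, not_false_eq_true, and_self, mul_one]
      have hp := mixed_pos hα₀ hα (score α η q (t - 1)) a
      have hm := G.meanL_mem_unit a (br a)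
      rw [← sub_div, abs_div, div_eq_mul_inv, abs_of_pos (a := exp3 α η q t a) hp]
      have h3 : |rewL (q t) - G.meanL a (br a)| ≤ 1 :=
        abs_sub_le_of_nonneg_of_le hr.1 hr.2 hm.1 hm.2
      calc _ ≤ 1 * (exp3 α η q t a)⁻¹ :=
            mul_le_mul_of_nonneg_right h3 (inv_nonneg.2 hp.le)
        _ ≤ _ := by rw [one_mul]; exact inv_mixed_le hα₀ hα _ a
  · simp [h1]

/-- True and idealized estimates agree except after wrong answers, where both rewards lie in the
unit interval and are divided by a weight of at least α/A. -/
lemma score_sub_score_le (hα₀ : 0 < α) (hα : α ≤ 1) (hη : 0 ≤ η) (br : 𝓐 → 𝓑) {T : ℕ}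
    (hT : 1 ≤ T) (hr : ∀ t ∈ Set.Icc 1 T, rewL (q t) ∈ Set.Icc (0 : ℝ) 1) (a a' : 𝓐) :
    score α η q (T - 1) a - score α η q (T - 1) a'
      ≤ η * (∑ τ ∈ Finset.Ico 1 T, (estimate G br α η q τ a - estimate G br α η q τ a')
        + Fintype.card 𝓐 / α * (wrongPlays br q T a + wrongPlays br q T a')) := by
  rw [score_eq_sum, score_eq_sum, ← mul_sub, Nat.sub_add_cancel hT]
  refine mul_le_mul_of_nonneg_left ?_ hη
  rw [wrongPlays, wrongPlays, ← Finset.sum_add_distrib, ← Finset.sum_sub_distrib, Finset.mul_sum,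
    ← Finset.sum_add_distrib]
  refine Finset.sum_le_sum fun τ hτ => ?_
  rw [Finset.mem_Ico] at hτ
  have h1 := abs_le.1 (abs_sub_estimate_le (G := G) (η := η) hα₀ hα br
    (hr τ ⟨hτ.1, hτ.2.le⟩) a)
  have h2 := abs_le.1 (abs_sub_estimate_le (G := G) (η := η) hα₀ hα br
    (hr τ ⟨hτ.1, hτ.2.le⟩) a')
  rw [mul_add]
  linarith [h1.2, h2.1]

/-- Each competing softmax weight is at most `Real.exp u` times the weight of `a₀`, which is at most
1; uniform mixing costs at most α more. -/
lemma one_sub_mixed_le (hα₀ : 0 ≤ α) (y : 𝓐 → ℝ) (a₀ : 𝓐) {u : ℝ}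
    (hu : ∀ a, a ≠ a₀ → y a - y a₀ ≤ u) :
    1 - mixed α y a₀ ≤ α + Fintype.card 𝓐 * Real.exp u := by
  have hS : 0 < ∑ a', Real.exp (y a') :=
    Finset.sum_pos (fun _ _ => Real.exp_pos _) Finset.univ_nonempty
  have h1 : 1 - softmax y a₀ ≤ Fintype.card 𝓐 * Real.exp u := by
    rw [softmax, one_sub_div hS.ne', div_le_iff₀ hS, ← Finset.sum_erase_eq_sub (Finset.mem_univ a₀)]
    calc ∑ a ∈ Finset.univ.erase a₀, Real.exp (y a)
        ≤ ∑ a ∈ Finset.univ.erase a₀, Real.exp u * Real.exp (y a₀) := by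
          refine Finset.sum_le_sum fun a ha => ?_
          rw [← Real.exp_add]
          exact Real.exp_le_exp.2 (by linarith [hu a (Finset.ne_of_mem_erase ha)])
      _ ≤ Fintype.card 𝓐 * (Real.exp u * Real.exp (y a₀)) := by
          rw [Finset.sum_const, nsmul_eq_mul]
          gcongr
          exact Finset.card_le_univ _
      _ ≤ _ := by
          rw [mul_assoc]
          gcongr
          exact Finset.single_le_sum (f := fun a => Real.exp (y a))
            (fun _ _ => (Real.exp_pos _).le) (Finset.mem_univ a₀)
  have h2 : 0 ≤ softmax y a₀ := softmax_nonneg y a₀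
  have h3 : softmax y a₀ ≤ 1 := by
    rw [softmax, div_le_one hS]
    exact Finset.single_le_sum (f := fun a => Real.exp (y a))
      (fun _ _ => (Real.exp_pos _).le) (Finset.mem_univ a₀)
  have h4 : 0 ≤ α * (1 / (Fintype.card 𝓐 : ℝ)) := by positivity
  unfold mixed
  nlinarith [mul_nonneg hα₀ h2]

end Scores

/-! ### Concentration of the follower's empirical means. -/

section Follower

variable {𝓐 𝓑 Ω : Type*} [Fintype 𝓐] [DecidableEq 𝓐] [MeasurableSpace 𝓐]
  [DiscreteMeasurableSpace 𝓐] [Fintype 𝓑] [DecidableEq 𝓑] [MeasurableSpace 𝓑]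
  [DiscreteMeasurableSpace 𝓑] [mΩ : MeasurableSpace Ω]
  {G : Game 𝓐 𝓑} {T : ℕ} {δ α η : ℝ} {P : Measure Ω} [IsProbabilityMeasure P]
  {h : ℕ → Ω → Round 𝓐 𝓑}

/-- A round contributes to the exponent only if (a,b) is played in it, and then Hoeffding's lemma
makes the compensated factor have mean at most one. The compensator is thus proportional to the
random number of plays. -/
lemma IsEXP3UCBRun.measureReal_follower_le (run : IsEXP3UCBRun G T δ α η P h) (a : 𝓐) (b : 𝓑)
    (lam u : ℝ) {t : ℕ} (ht : t ∈ Set.Icc 1 T) :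
    P.real {ω | u ≤ ∑ τ ∈ Finset.Ico 1 t, if actL (h τ ω) = a ∧ actF (h τ ω) = b then
      lam * (clip (rewF (h τ ω)) - G.meanF a b) - lam ^ 2 / 8 else 0} ≤ Real.exp (-u) := by
  have hm := G.meanF_mem_unit a b
  have hdev : ∀ r, |lam * (clip r - G.meanF a b)| ≤ |lam| := fun r => by
    rw [abs_mul]
    exact mul_le_of_le_one_right (abs_nonneg _)
      (abs_sub_le_of_nonneg_of_le (clip_nonneg _) (clip_le_one _) hm.1 hm.2)
  refine measureReal_le_sum_le_exp_neg (P := P) (𝓕 := past h) (T := T)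
    (X := fun τ ω => if actL (h τ ω) = a ∧ actF (h τ ω) = b then
      lam * (clip (rewF (h τ ω)) - G.meanF a b) - lam ^ 2 / 8 else 0) (C := |lam| + lam ^ 2 / 8)
    (fun s t hst => past_mono h hst) (fun t ht => run.past_le (ht.trans T.le_succ)) ?_ ?_ ?_
    ht.1 ht.2 u
  · intro τ hτ
    have hD := pastAndActions_le_past h hτ.1 _ (measurableSet_actions h τ a b)
    have hq := measurable_past (h := h) hτ.1 τ.lt_succ_self
    let _ := past h (τ + 1)
    refine Measurable.ite hD ?_ measurable_const
    exact (((measurable_clip.comp (measurable_rewF.comp hq)).sub_const _).const_mul _).sub_const _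
  · intro τ ω
    split_ifs
    · refine (abs_sub _ _).trans (add_le_add (hdev _) (le_of_eq ?_))
      exact abs_of_nonneg (by positivity)
    · rw [abs_zero]; positivity
  · intro τ hτ g hg hg0 K hgK
    have hτ' : τ ∈ Set.Icc 1 T := ⟨hτ.1, hτ.2.le⟩
    have hle := run.past_le (hτ'.2.trans T.le_succ)
    have hgm : Measurable g := hg.mono hle le_rfl
    have hgi : Integrable g P := integrable_of_abs_le hgm hgK
    have hφ : Measurable fun r : ℝ × ℝ => Real.exp (lam * (clip r.2 - G.meanF a b)) :=
      Real.measurable_exp.comp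
        (((measurable_clip.comp measurable_snd).sub_const _).const_mul _)
    have hφK : ∀ r : ℝ × ℝ, |Real.exp (lam * (clip r.2 - G.meanF a b))| ≤ Real.exp |lam| :=
      fun r => by
        rw [abs_of_pos (Real.exp_pos _)]
        exact Real.exp_le_exp.2 ((le_abs_self _).trans (hdev _))
    have e := run.integral_mul_reward hτ' a b
      (hg.mono (past_le_pastAndActions h τ) le_rfl) hgK hφ hφK
    set D := {ω | actL (h τ ω) = a ∧ actF (h τ ω) = b} with hD
    have hDm : MeasurableSet D := run.pastAndActions_le hτ' _ (measurableSet_actions h τ a b)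
    have i1 : Integrable (fun ω => g ω * D.indicator
        (fun ω => Real.exp (lam * (clip (rewF (h τ ω)) - G.meanF a b))) ω) P := by
      refine hgi.mul_bdd (c := Real.exp |lam|)
        ((hφ.comp (run.measurable_rewards hτ')).indicator hDm).aestronglyMeasurable
        (Filter.Eventually.of_forall fun ω => ?_)
      by_cases hω : ω ∈ D
      · simpa [hω] using hdev (rewF (h τ ω)) |>.trans' (le_abs_self _)
      · simp [hω, (Real.exp_pos _).le]
    have i2 : Integrable (fun ω => g ω * D.indicator (fun _ => 1) ω) P := by
      refine hgi.mul_bdd (c := 1) (measurable_const.indicator hDm).aestronglyMeasurable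
        (Filter.Eventually.of_forall fun ω => ?_)
      by_cases hω : ω ∈ D <;> simp [hω]
    have i3 : Integrable (fun ω => Real.exp (-(lam ^ 2 / 8)) * (g ω * D.indicator
        (fun ω => Real.exp (lam * (clip (rewF (h τ ω)) - G.meanF a b))) ω)
        - g ω * D.indicator (fun _ => 1) ω) P := (i1.const_mul _).sub i2
    have hdec : ∀ ω, g ω * Real.exp (if actL (h τ ω) = a ∧ actF (h τ ω) = b then
        lam * (clip (rewF (h τ ω)) - G.meanF a b) - lam ^ 2 / 8 else 0)
        = g ω + (Real.exp (-(lam ^ 2 / 8)) * (g ω * D.indicator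
          (fun ω => Real.exp (lam * (clip (rewF (h τ ω)) - G.meanF a b))) ω)
          - g ω * D.indicator (fun _ => 1) ω) := fun ω => by
      by_cases hω : actL (h τ ω) = a ∧ actF (h τ ω) = b
      · rw [if_pos hω, Set.indicator_of_mem (show ω ∈ D from hω),
          Set.indicator_of_mem (show ω ∈ D from hω), sub_eq_add_neg, Real.exp_add]
        ring
      · rw [if_neg hω, Set.indicator_of_notMem (show ω ∉ D from hω),
          Set.indicator_of_notMem (show ω ∉ D from hω), Real.exp_zero]
        ring
    simp_rw [hdec]
    rw [integral_add hgi i3, integral_sub (i1.const_mul _) i2, integral_const_mul, e]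
    have h1 := G.integral_exp_clip_le a b lam
    have h2 : 0 ≤ ∫ ω, g ω * D.indicator (fun _ => 1) ω ∂P :=
      integral_nonneg fun ω => mul_nonneg (hg0 ω) (Set.indicator_nonneg (fun _ _ => zero_le_one) ω)
    have h3 : Real.exp (-(lam ^ 2 / 8)) *
        ∫ r, Real.exp (lam * (clip r.2 - G.meanF a b)) ∂(G.reward a b) ≤ 1 := by
      calc _ ≤ Real.exp (-(lam ^ 2 / 8)) * Real.exp (lam ^ 2 / 8) :=
            mul_le_mul_of_nonneg_left h1 (Real.exp_pos _).le
        _ = 1 := by rw [← Real.exp_add]; simp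
    nlinarith [mul_le_mul_of_nonneg_right h3 h2]

/-- The best tilt depends on the random count n, so there is a union bound over t, n, a, b and the
sign, with a deterministic tilt for each choice: at most 2ABT² events. -/
lemma IsEXP3UCBRun.measureReal_not_concentrated_le (run : IsEXP3UCBRun G T δ α η P h)
    (hl : 0 ≤ Real.log (T / δ)) :
    P.real {ω | ¬ Concentrated G T δ fun τ => h τ ω}
      ≤ 2 * Fintype.card 𝓐 * Fintype.card 𝓑 * T ^ 2 * Real.exp (-(4 * Real.log (T / δ))) := by
  set l := Real.log (T / δ) with hl'
  let X : ℝ → 𝓐 → 𝓑 → ℕ → Ω → ℝ := fun lam a b t ω =>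
    ∑ τ ∈ Finset.Ico 1 t, if actL (h τ ω) = a ∧ actF (h τ ω) = b then
      lam * (clip (rewF (h τ ω)) - G.meanF a b) - lam ^ 2 / 8 else 0
  let I : Finset ((ℕ × ℕ) × (𝓐 × 𝓑 × Bool)) :=
    (Finset.Icc 1 T ×ˢ Finset.Icc 1 T) ×ˢ Finset.univ
  let E : (ℕ × ℕ) × (𝓐 × 𝓑 × Bool) → Set Ω := fun i =>
    {ω | 4 * l ≤ X ((if i.2.2.2 then 1 else -1) * (4 * Real.sqrt (2 * l / i.1.2)))
      i.2.1 i.2.2.1 i.1.1 ω}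
  have hunit : ∀ᵐ ω ∂P, ∀ t ∈ Set.Icc 1 T, rewF (h t ω) ∈ Set.Icc (0 : ℝ) 1 := by
    rw [ae_ball_iff (Set.to_countable _)]
    exact fun t ht => (run.ae_mem_unit ht).mono fun ω hω => hω.2
  have hsub : {ω | ¬ Concentrated G T δ fun τ => h τ ω} ≤ᵐ[P] (⋃ i ∈ I, E i : Set Ω) := by
    filter_upwards [hunit] with ω hω hbad
    change ¬ Concentrated G T δ (fun τ => h τ ω) at hbad
    unfold Concentrated at hbad
    push Not at hbad
    obtain ⟨t, ht, a, b, hab⟩ := hbad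
    set n := plays (fun τ => h τ ω) t a b with hn
    have htot : totalF (fun τ => h τ ω) t a b = ∑ τ ∈ Finset.Ico 1 t,
        if actL (h τ ω) = a ∧ actF (h τ ω) = b then clip (rewF (h τ ω)) else 0 := by
      refine Finset.sum_congr rfl fun τ hτ => ?_
      rw [Finset.mem_Ico] at hτ
      rw [clip_of_mem (hω τ ⟨hτ.1, hτ.2.le.trans ht.2⟩)]
    set S := totalF (fun τ => h τ ω) t a b with hS
    have hX : ∀ lam, X lam a b t ω = lam * (S - G.meanF a b * n) - lam ^ 2 / 8 * n := by
      intro lam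
      rw [htot, hn, ← sum_ite_eq_plays]
      simp only [X]
      rw [Finset.mul_sum, Finset.mul_sum, ← Finset.sum_sub_distrib, Finset.mul_sum,
        ← Finset.sum_sub_distrib]
      refine Finset.sum_congr rfl fun τ _ => ?_
      split_ifs <;> ring
    -- The tilt divides by n; with no plays both sides of the concentration inequality are 0, so it
    -- cannot fail.
    have hn0 : n ≠ 0 := by
      intro h0
      rw [h0] at hab
      have : S = 0 := by
        have h0' : ∀ τ ∈ Finset.Ico 1 t, ¬ (actL (h τ ω) = a ∧ actF (h τ ω) = b) := by
          have := hn ▸ h0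
          rw [plays, Finset.card_eq_zero, Finset.filter_eq_empty_iff] at this
          exact fun τ hτ => this hτ
        rw [hS, totalF]
        exact Finset.sum_eq_zero fun τ hτ => if_neg (h0' τ hτ)
      rw [this] at hab
      simp at hab
    have hn1 : (0 : ℝ) < n := by exact_mod_cast Nat.pos_of_ne_zero hn0
    have hnT : n ≤ T := by
      have h1 := StackelbergLearning.plays_le (fun τ => h τ ω) t a b
      have h2 := ht.2
      omega
    -- The tilt 4√(2l/n) maximizes the exponent at the threshold: the linear term is at least 8l and
    -- the compensator is 4l.
    have hlam : ∀ v, Real.sqrt (2 * l * n) < v →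
        4 * l ≤ 4 * Real.sqrt (2 * l / n) * v - (4 * Real.sqrt (2 * l / n)) ^ 2 / 8 * n := by
      intro v hv
      have h1 : Real.sqrt (2 * l / n) * Real.sqrt (2 * l * n) = 2 * l := by
        rw [← Real.sqrt_mul (by positivity)]
        have : 2 * l / n * (2 * l * n) = (2 * l) ^ 2 := by field_simp
        rw [this, Real.sqrt_sq (by positivity)]
      have h2 : Real.sqrt (2 * l / n) ^ 2 * n = 2 * l := by
        rw [Real.sq_sqrt (by positivity)]; field_simp
      have h3 := mul_le_mul_of_nonneg_left hv.le (Real.sqrt_nonneg (2 * l / n))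
      nlinarith
    change ω ∈ ⋃ i ∈ I, E i
    simp only [Set.mem_iUnion, exists_prop]
    have hmem : ∀ s : Bool, (((t, n), (a, b, s)) : (ℕ × ℕ) × (𝓐 × 𝓑 × Bool)) ∈ I := fun s => by
      simp only [I, Finset.mem_product, Finset.mem_Icc, Finset.mem_univ, and_true]
      exact ⟨⟨ht.1, ht.2⟩, Nat.pos_of_ne_zero hn0, hnT⟩
    rcases lt_abs.1 hab with hpos | hneg
    · refine ⟨((t, n), (a, b, true)), hmem _, ?_⟩
      change 4 * l ≤ X _ a b t ω
      rw [hX]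
      simpa using hlam _ hpos
    · refine ⟨((t, n), (a, b, false)), hmem _, ?_⟩
      change 4 * l ≤ X _ a b t ω
      rw [hX]
      have := hlam _ hneg
      simp only [Bool.false_eq_true, if_false]
      linarith
  calc _ ≤ P.real (⋃ i ∈ I, E i) :=
        ENNReal.toReal_mono (measure_ne_top _ _) (measure_mono_ae hsub)
    _ ≤ ∑ i ∈ I, P.real (E i) := measureReal_biUnion_finset_le _ _
    _ ≤ ∑ i ∈ I, Real.exp (-(4 * l)) := by
        refine Finset.sum_le_sum fun i hi => run.measureReal_follower_le _ _ _ _ ?_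
        simp only [I, Finset.mem_product, Finset.mem_Icc] at hi
        exact hi.1.1
    _ = _ := by
        rw [Finset.sum_const, nsmul_eq_mul]
        congr 1
        simp [I, Finset.card_product]
        ring

end Follower

/-! ### Optimized tilt and the probability of a bad last iterate. -/

/-- The unconstrained optimum √(L/V) balances the two terms. If it violates the constraint, the
boundary value 1/R works, since then V ≤ LR². -/
lemma exists_mul_add_div_le {V L R : ℝ} (hV : 0 < V) (hL : 0 < L) (hR : 0 < R) :
    ∃ lam, 0 < lam ∧ lam * R ≤ 1 ∧ lam * V + L / lam ≤ 2 * Real.sqrt (V * L) + 2 * L * R := by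
  set s := Real.sqrt (L / V) with hs
  have hs0 : 0 < s := Real.sqrt_pos.2 (by positivity)
  have hs2 : s ^ 2 * V = L := by rw [hs, Real.sq_sqrt (by positivity)]; field_simp
  rcases le_total (s * R) 1 with h | h
  · refine ⟨s, hs0, h, ?_⟩
    have h1 : Real.sqrt (V * L) = s * V := by
      rw [← hs2, show V * (s ^ 2 * V) = (s * V) ^ 2 by ring, Real.sqrt_sq (by positivity)]
    have h2 : L / s = s * V := by rw [div_eq_iff hs0.ne', ← hs2]; ring
    rw [h1, h2]
    nlinarith [mul_pos hL hR]
  · refine ⟨1 / R, by positivity, by rw [one_div, inv_mul_cancel₀ hR.ne'], ?_⟩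
    have h1 : V ≤ L * R ^ 2 := by
      have : 1 ≤ (s * R) ^ 2 := one_le_pow₀ h
      calc V = V * 1 := (mul_one V).symm
        _ ≤ V * (s * R) ^ 2 := by gcongr
        _ = L * R ^ 2 := by rw [← hs2]; ring
    have h2 : 1 / R * V ≤ L * R := by
      rw [one_div_mul_eq_div, div_le_iff₀ hR]; linarith
    have h3 : L / (1 / R) = L * R := by field_simp
    rw [h3]
    linarith [Real.sqrt_nonneg (V * L)]

section LastIterate

variable {𝓐 𝓑 Ω : Type*} [Fintype 𝓐] [DecidableEq 𝓐] [Nontrivial 𝓐] [MeasurableSpace 𝓐]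
  [DiscreteMeasurableSpace 𝓐] [Fintype 𝓑] [DecidableEq 𝓑] [Nontrivial 𝓑] [MeasurableSpace 𝓑]
  [DiscreteMeasurableSpace 𝓑] [mΩ : MeasurableSpace Ω]
  {G : Game 𝓐 𝓑} {br : 𝓐 → 𝓑} {ase : 𝓐}
  {T : ℕ} {δ α η : ℝ} {P : Measure Ω} [IsProbabilityMeasure P]
  {h : ℕ → Ω → Round 𝓐 𝓑}

/-- Upper bound for the advantage, in cumulative estimated reward, of a suboptimal leader action
over the Stackelberg action, valid outside an event of probability about `A * exp (-L)`. -/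
def advantageBound (G : Game 𝓐 𝓑) (br : 𝓐 → 𝓑) (ase : 𝓐) (T : ℕ) (δ α L : ℝ) : ℝ :=
  -(G.gapL br ase) * (T - 1)
    + 2 * Real.sqrt (3 / 4 * (2 * (Fintype.card 𝓐 / α)) * T * L)
    + 2 * L * (Fintype.card 𝓐 / α)
    + Fintype.card 𝓐 / α *
      (2 * (Fintype.card 𝓑 * (8 * Real.log (T / δ) / G.gapF br ^ 2 + 1)))

/-- The bad event is covered by a Bernstein failure for some competitor of `ase` or a failure of the
follower's concentration; outside these the score bound is deterministic. -/
lemma IsEXP3UCBRun.measureReal_lastIterate_le (run : IsEXP3UCBRun G T δ α η P h)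
    (hbr : G.IsUniqueBestResponse br) (hα₀ : 0 < α) (hα : α ≤ 1) (hη : 0 ≤ η) (hT : 1 ≤ T)
    (hl : 1 ≤ Real.log (T / δ)) {L : ℝ} (hL : 0 < L) :
    P.real {ω | ¬ 1 - exp3 α η (fun τ => h τ ω) T ase
        ≤ α + Fintype.card 𝓐 * Real.exp (η * advantageBound G br ase T δ α L)}
      ≤ Fintype.card 𝓐 * Real.exp (-L)
        + 2 * Fintype.card 𝓐 * Fintype.card 𝓑 * T ^ 2 * Real.exp (-(4 * Real.log (T / δ))) := by
  set R : ℝ := Fintype.card 𝓐 / α with hR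
  have hR0 : 0 < R := div_pos (Nat.cast_pos.2 Fintype.card_pos) hα₀
  have hT0 : (0 : ℝ) < T := by exact_mod_cast hT
  obtain ⟨lam, hlam, hlam1, hlamb⟩ := exists_mul_add_div_le
    (V := 3 / 4 * (2 * R) * T) (by positivity) hL hR0
  let E : 𝓐 → Set Ω := fun a => {ω | (G.meanL a (br a) - G.meanL ase (br ase)) * (T - 1)
        + 3 / 4 * lam * (2 * R) * T + L / lam
      ≤ ∑ τ ∈ Finset.Ico 1 T, (estimate G br α η (fun τ => h τ ω) τ a
          - estimate G br α η (fun τ => h τ ω) τ ase)}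
  let I : Finset 𝓐 := Finset.univ.erase ase
  have hunit : ∀ᵐ ω ∂P, ∀ t ∈ Set.Icc 1 T, rewL (h t ω) ∈ Set.Icc (0 : ℝ) 1 := by
    rw [ae_ball_iff (Set.to_countable _)]
    exact fun t ht => (run.ae_mem_unit ht).mono fun ω hω => hω.1
  have hfoll : ∀ᵐ ω ∂P, ∀ t ∈ Set.Icc 1 T, ∀ b, ucbF T δ (fun τ => h τ ω) t (actL (h t ω)) b
      ≤ ucbF T δ (fun τ => h τ ω) t (actL (h t ω)) (actF (h t ω)) := by
    rw [ae_ball_iff (Set.to_countable _)]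
    exact run.follower
  have hsub : {ω | ¬ 1 - exp3 α η (fun τ => h τ ω) T ase
        ≤ α + Fintype.card 𝓐 * Real.exp (η * advantageBound G br ase T δ α L)} ≤ᵐ[P]
      ((⋃ a ∈ I, E a) ∪ {ω | ¬ Concentrated G T δ fun τ => h τ ω} : Set Ω) := by
    filter_upwards [hunit, hfoll] with ω hω hfo hbad
    change ω ∈ (⋃ a ∈ I, E a) ∪ {ω | ¬ Concentrated G T δ fun τ => h τ ω}
    by_contra hgood
    simp only [Set.mem_union, not_or, Set.mem_iUnion, exists_prop, not_exists, not_and,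
      Set.mem_ofPred_eq, not_not, E, I, Finset.mem_erase, Finset.mem_univ, and_true,
      not_le] at hgood
    obtain ⟨hE, hC⟩ := hgood
    refine hbad (one_sub_mixed_le hα₀.le _ ase fun a ha => ?_)
    refine (score_sub_score_le (G := G) hα₀ hα hη br hT hω a ase).trans
      (mul_le_mul_of_nonneg_left ?_ hη)
    have h1 := hC.wrongPlays_le (G.gapF_pos hbr) hl hfo a ⟨hT, le_rfl⟩
    have h2 := hC.wrongPlays_le (G.gapF_pos hbr) hl hfo ase ⟨hT, le_rfl⟩
    have h3 := (hE a ha).le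
    have h4 := G.gapL_le (br := br) ha
    have h5 : (0 : ℝ) ≤ T - 1 := by
      rw [sub_nonneg]; exact_mod_cast hT
    have h6 := mul_le_mul_of_nonneg_right h4 h5
    have h7 := mul_le_mul_of_nonneg_left (add_le_add h1 h2) hR0.le
    unfold advantageBound
    rw [← hR]
    linarith
  calc _ ≤ P.real ((⋃ a ∈ I, E a) ∪ {ω | ¬ Concentrated G T δ fun τ => h τ ω}) :=
        ENNReal.toReal_mono (measure_ne_top _ _) (measure_mono_ae hsub)
    _ ≤ P.real (⋃ a ∈ I, E a) + P.real {ω | ¬ Concentrated G T δ fun τ => h τ ω} :=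
        measureReal_union_le _ _
    _ ≤ _ := by
        refine add_le_add ?_ (run.measureReal_not_concentrated_le (by linarith))
        calc _ ≤ ∑ a ∈ I, P.real (E a) := measureReal_biUnion_finset_le _ _
          _ ≤ ∑ a ∈ I, Real.exp (-L) := Finset.sum_le_sum fun a ha =>
              run.measureReal_sum_estimate_le hα₀ hα br (Finset.ne_of_mem_erase ha) hT hlam
                hlam1 L
          _ ≤ _ := by
              rw [Finset.sum_const, nsmul_eq_mul]
              gcongr
              exact Finset.card_le_univ _

lemma IsEXP3UCBRun.condExp_actL_ne (run : IsEXP3UCBRun G T δ α η P h) (hT : 1 ≤ T) (a : 𝓐) :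
    P⟦{ω | actL (h T ω) ≠ a} | past h T⟧ =ᵐ[P] fun ω => 1 - exp3 α η (fun τ => h τ ω) T a := by
  have hle := run.past_le T.le_succ
  have hD : MeasurableSet {ω | actL (h T ω) = a} :=
    run.pastAndActions_le ⟨hT, le_rfl⟩ _ (measurableSet_actL h T a)
  have e : {ω | actL (h T ω) ≠ a}.indicator (fun _ => (1 : ℝ))
      = (fun _ => 1) - {ω | actL (h T ω) = a}.indicator fun _ => (1 : ℝ) := by
    ext ω
    by_cases hω : actL (h T ω) = a <;> simp [hω]
  rw [e]
  filter_upwards [condExp_sub (integrable_const (1 : ℝ))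
    ((integrable_const (1 : ℝ)).indicator hD) (past h T), run.leader T ⟨hT, le_rfl⟩ a]
    with ω h1 h2
  rw [h1, Pi.sub_apply, h2, condExp_const hle]

/-- Averaging the conditional probability: at most c off the exceptional event, at most 1 on it. -/
lemma IsEXP3UCBRun.measureReal_actL_ne_le (run : IsEXP3UCBRun G T δ α η P h) (hT : 1 ≤ T)
    (hα₀ : 0 < α) (hα : α ≤ 1) (a : 𝓐) {c : ℝ} (hc : 0 ≤ c) :
    P.real {ω | actL (h T ω) ≠ a}
      ≤ c + P.real {ω | ¬ 1 - exp3 α η (fun τ => h τ ω) T a ≤ c} := by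
  have hle := run.past_le T.le_succ
  have hD : MeasurableSet {ω | actL (h T ω) ≠ a} :=
    (run.pastAndActions_le ⟨hT, le_rfl⟩ _ (measurableSet_actL h T a)).compl
  have hxm : Measurable fun ω => exp3 α η (fun τ => h τ ω) T a :=
    (measurable_exp3 h α η hT a).mono hle le_rfl
  set B := {ω | ¬ 1 - exp3 α η (fun τ => h τ ω) T a ≤ c} with hB
  have hBm : MeasurableSet B := (measurableSet_le (measurable_const.sub hxm) measurable_const).compl
  have hi : Integrable (fun ω => c + B.indicator (fun _ => (1 : ℝ)) ω) P :=
    (integrable_const c).add ((integrable_const (1 : ℝ)).indicator hBm)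
  calc P.real {ω | actL (h T ω) ≠ a}
      = ∫ ω, {ω | actL (h T ω) ≠ a}.indicator (fun _ => (1 : ℝ)) ω ∂P := by
        rw [integral_indicator hD, setIntegral_const, smul_eq_mul, mul_one]
    _ = ∫ ω, (P⟦{ω | actL (h T ω) ≠ a} | past h T⟧) ω ∂P := (integral_condExp hle).symm
    _ ≤ ∫ ω, (c + B.indicator (fun _ => (1 : ℝ)) ω) ∂P := by
        refine integral_mono_ae integrable_condExp hi ?_
        filter_upwards [run.condExp_actL_ne hT a] with ω hω
        rw [hω]
        by_cases hωB : ω ∈ B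
        · simp only [hωB, Set.indicator_of_mem]
          linarith [mixed_pos hα₀ hα (score α η (fun τ => h τ ω) (T - 1)) a,
            show exp3 α η (fun τ => h τ ω) T a
              = mixed α (score α η (fun τ => h τ ω) (T - 1)) a from rfl]
        · have : 1 - exp3 α η (fun τ => h τ ω) T a ≤ c := not_not.1 hωB
          simpa [hωB] using this
    _ = c + P.real B := by
        rw [integral_add (integrable_const c) ((integrable_const (1 : ℝ)).indicator hBm),
          integral_indicator hBm, setIntegral_const]
        simp

end LastIterate

/-! ### Rates with x = T^(1/3), and the two parts of the theorem. -/

lemma cube_rpow_third (T : ℕ) : ((T : ℝ) ^ (1 / 3 : ℝ)) ^ 3 = T := by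
  rw [← Real.rpow_natCast, ← Real.rpow_mul (Nat.cast_nonneg T)]
  norm_num

lemma sq_rpow_third (T : ℕ) : ((T : ℝ) ^ (1 / 3 : ℝ)) ^ 2 = (T : ℝ) ^ (2 / 3 : ℝ) := by
  rw [← Real.rpow_natCast, ← Real.rpow_mul (Nat.cast_nonneg T)]
  norm_num

lemma rpow_neg_third (T : ℕ) : (T : ℝ) ^ (-(1 / 3) : ℝ) = ((T : ℝ) ^ (1 / 3 : ℝ))⁻¹ :=
  Real.rpow_neg (Nat.cast_nonneg T) _

lemma exp_neg_four_mul_log_div {T δ : ℝ} (hT : 0 < T) (hδ : 0 < δ) :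
    T ^ 2 * Real.exp (-(4 * Real.log (T / δ))) = δ ^ 4 / T ^ 2 := by
  have : -(4 * Real.log (T / δ)) = Real.log ((δ / T) ^ 4) := by
    rw [Real.log_pow, ← inv_div, Real.log_inv]; push_cast; ring
  rw [this, Real.exp_log (by positivity)]
  field_simp

section

variable {𝓐 𝓑 Ω : Type*} [Fintype 𝓐] [DecidableEq 𝓐] [Nontrivial 𝓐] [MeasurableSpace 𝓐]
  [DiscreteMeasurableSpace 𝓐] [Fintype 𝓑] [DecidableEq 𝓑] [Nontrivial 𝓑] [MeasurableSpace 𝓑]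
  [DiscreteMeasurableSpace 𝓑] [mΩ : MeasurableSpace Ω]
  {G : Game 𝓐 𝓑} {br : 𝓐 → 𝓑} {ase : 𝓐}
  {T : ℕ} {δ : ℝ} {P : Measure Ω} [IsProbabilityMeasure P]
  {h : ℕ → Ω → Round 𝓐 𝓑}

lemma advantageBound_eq (G : Game 𝓐 𝓑) (br : 𝓐 → 𝓑) (ase : 𝓐) (δ cα L : ℝ) {x : ℝ}
    (hx : x ^ 3 = T) :
    advantageBound G br ase T δ (cα * x⁻¹) L
      = -(G.gapL br ase) * (x ^ 3 - 1) + 2 * (Real.sqrt (3 / 2 * (Fintype.card 𝓐 / cα) * L) * x ^ 2)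
        + 2 * L * (Fintype.card 𝓐 / cα) * x
        + Fintype.card 𝓐 / cα * x *
          (2 * (Fintype.card 𝓑 * (8 * Real.log (T / δ) / G.gapF br ^ 2 + 1))) := by
  have h1 : (Fintype.card 𝓐 : ℝ) / (cα * x⁻¹) = Fintype.card 𝓐 / cα * x := by
    rw [div_mul_eq_div_div, div_inv_eq_mul]
  have h2 : Real.sqrt (3 / 4 * (2 * (Fintype.card 𝓐 / (cα * x⁻¹))) * T * L)
      = Real.sqrt (3 / 2 * (Fintype.card 𝓐 / cα) * L) * x ^ 2 := by
    rw [h1, ← hx, ← Real.sqrt_sq (sq_nonneg x), ← Real.sqrt_mul' _ (sq_nonneg (x ^ 2))]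
    congr 1
    ring
  rw [advantageBound, h2, h1, ← hx]
  ring

/-- The exponent of the last-iterate bound, with `x = T ^ (1/3)`. -/
lemma advantageBound_le_exponent (hgap : 0 < G.gapF br) {x cα L : ℝ} (hx : x ^ 3 = T)
    (hx1 : 1 ≤ x) (hcα : 1 ≤ cα) (hL : 3 / 4 * L ≤ cα * Real.log (2 / δ))
    (hl : 1 ≤ Real.log (T / δ)) (hδ : 1 ≤ Real.log (1 / δ))
    (hδ2 : Real.log (2 / δ) ≤ 2 * Real.log (1 / δ)) :
    advantageBound G br ase T δ (cα * x⁻¹) L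
      ≤ x * (-(G.gapL br ase) * x ^ 2 + 2 * Real.sqrt (2 * Fintype.card 𝓐 * Real.log (2 / δ)) * x
        + 25 * Fintype.card 𝓐 * Fintype.card 𝓑 / G.gapF br ^ 2 * Real.log (T / δ)
          * Real.log (1 / δ)) := by
  rw [advantageBound_eq G br ase δ cα L hx]
  have hg1 : G.gapF br ≤ 1 := G.gapF_le_one
  have hL1 : G.gapL br ase ≤ 1 := G.gapL_le_one
  set A : ℝ := (Fintype.card 𝓐 : ℝ)
  set B : ℝ := (Fintype.card 𝓑 : ℝ)
  set l := Real.log (T / δ)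
  set D := Real.log (1 / δ)
  set D2 := Real.log (2 / δ)
  set g := G.gapF br
  have hA : 1 ≤ A := Nat.one_le_cast.2 Fintype.card_pos
  have hB : 1 ≤ B := Nat.one_le_cast.2 Fintype.card_pos
  have hx0 : 0 < x := by linarith
  have hc0 : 0 < cα := by linarith
  have hLc : L / cα ≤ 4 / 3 * D2 := by rw [div_le_iff₀ hc0]; linarith
  have hs : Real.sqrt (3 / 2 * (A / cα) * L) ≤ Real.sqrt (2 * A * D2) := by
    refine Real.sqrt_le_sqrt ?_
    calc 3 / 2 * (A / cα) * L = 3 / 2 * A * (L / cα) := by ring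
      _ ≤ 3 / 2 * A * (4 / 3 * D2) := by gcongr
      _ = _ := by ring
  have hgi : 1 ≤ 1 / g ^ 2 := by
    rw [le_div_iff₀ (by positivity), one_mul]; exact pow_le_one₀ hgap.le hg1
  -- `Q` dominates every lower-order term, since all its factors are at least 1.
  set w := 1 / g ^ 2
  set Q := A * B * w * l * D
  have hQA : A * D ≤ Q := by
    calc A * D = A * 1 * 1 * 1 * D := by ring
      _ ≤ A * B * w * l * D := by gcongr
  have hQ1 : 1 ≤ Q := le_trans (by nlinarith) hQA
  have hQB : A * B * w * l ≤ Q := le_mul_of_one_le_right (by positivity) hδ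
  have hQC : A * B ≤ A * B * w * l := by
    calc A * B = A * B * 1 * 1 := by ring
      _ ≤ A * B * w * l := by gcongr
  have t1 : 2 * L * (A / cα) * x ≤ 16 / 3 * Q * x := by
    refine mul_le_mul_of_nonneg_right ?_ hx0.le
    calc 2 * L * (A / cα) = 2 * A * (L / cα) := by ring
      _ ≤ 2 * A * (4 / 3 * (2 * D)) := by gcongr; linarith
      _ = 16 / 3 * (A * D) := by ring
      _ ≤ _ := by gcongr
  have t2 : A / cα * x * (2 * (B * (8 * l / g ^ 2 + 1))) ≤ 18 * Q * x := by
    calc A / cα * x * (2 * (B * (8 * l / g ^ 2 + 1)))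
        ≤ A * x * (2 * (B * (8 * l / g ^ 2 + 1))) := by
          gcongr
          exact div_le_self (by linarith) hcα
      _ = (16 * (A * B * w * l) + 2 * (A * B)) * x := by simp only [w]; ring
      _ ≤ (16 * Q + 2 * Q) * x := by gcongr; linarith
      _ = _ := by ring
  have t3 : G.gapL br ase ≤ Q * x := by nlinarith
  have t4 := mul_le_mul_of_nonneg_right hs (sq_nonneg x)
  have e : 25 * A * B / g ^ 2 * l * D = 25 * Q := by simp only [Q, w]; ring
  have hQx : 0 ≤ Q * x := by positivity
  rw [e]
  -- The constant 25 covers 16/3 from the Bernstein boundary term, 18 from the wrong answers and 1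
  -- from T-1 in place of T in the drift.
  nlinarith

theorem IsEXP3UCBRun.condExp_actL_ne_le {cα cη : ℝ} (hbr : G.IsUniqueBestResponse br)
    (hT : 1 ≤ T) (hδ₀ : 0 < δ) (hcα : 1 ≤ cα) (hcη : 1 ≤ cη)
    (hc : 1 + Real.log (Fintype.card 𝓐) ≤ cα ∨ δ ≤ (T : ℝ) ^ (-3 : ℝ))
    (hα : cα * (T : ℝ) ^ (-(1 / 3) : ℝ) ≤ 1)
    (run : IsEXP3UCBRun G T δ (cα * (T : ℝ) ^ (-(1 / 3) : ℝ))
      (cη * (T : ℝ) ^ (-(1 / 3) : ℝ)) P h) :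
    1 - 3 * δ ≤ P.real {ω | (P⟦{ω' | actL (h T ω') ≠ ase} | past h T⟧) ω
      ≤ cα * (T : ℝ) ^ (-(1 / 3) : ℝ) + Fintype.card 𝓐 * Real.exp (
          -(G.gapL br ase) * (T : ℝ) ^ (2 / 3 : ℝ)
          + 2 * Real.sqrt (2 * Fintype.card 𝓐 * Real.log (2 / δ)) * (T : ℝ) ^ (1 / 3 : ℝ)
          + 25 * Fintype.card 𝓐 * Fintype.card 𝓑 / (G.gapF br) ^ 2
              * Real.log (T / δ) * Real.log (1 / δ))} := by
  -- For δ ≥ 1/3 the claimed probability is nonpositive; below 1/3, log(1/δ) ≥ 1 because e < 3.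
  rcases le_or_gt (1 / 3) δ with hδ | hδ
  · exact le_trans (by linarith) measureReal_nonneg
  have hT0 : (0 : ℝ) < T := by exact_mod_cast hT
  have hT1 : (1 : ℝ) ≤ T := by exact_mod_cast hT
  rw [← sq_rpow_third, rpow_neg_third] at *
  set x : ℝ := (T : ℝ) ^ (1 / 3 : ℝ) with hxdef
  have hx3 : x ^ 3 = T := cube_rpow_third T
  have hx1 : 1 ≤ x := Real.one_le_rpow hT1 (by norm_num)
  have hx0 : 0 < x := by linarith
  have hα₀ : 0 < cα * x⁻¹ := by positivity
  set A : ℝ := (Fintype.card 𝓐 : ℝ) with hAdef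
  set B : ℝ := (Fintype.card 𝓑 : ℝ) with hBdef
  have hA : 1 ≤ A := Nat.one_le_cast.2 Fintype.card_pos
  have hB : 1 ≤ B := Nat.one_le_cast.2 Fintype.card_pos
  set E : ℝ := -(G.gapL br ase) * x ^ 2 + 2 * Real.sqrt (2 * A * Real.log (2 / δ)) * x
    + 25 * A * B / G.gapF br ^ 2 * Real.log (T / δ) * Real.log (1 / δ) with hE
  have hcond := run.condExp_actL_ne hT ase
  -- A nonnegative exponent makes the bound at least 1 and the claim trivial. A negative one is
  -- informative: it makes `cη * E ≤ E` and forces T to be large compared with AB.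
  rcases le_or_gt 0 E with hE0 | hE0
  · have : ∀ᵐ ω ∂P, (P⟦{ω' | actL (h T ω') ≠ ase} | past h T⟧) ω ≤ cα * x⁻¹ + A * Real.exp E := by
      filter_upwards [hcond] with ω hω
      rw [hω]
      have h1 : 1 ≤ A * Real.exp E := one_le_mul_of_one_le_of_one_le hA (Real.one_le_exp hE0)
      have h2 : 0 < exp3 (cα * x⁻¹) (cη * x⁻¹) (fun τ => h τ ω) T ase := mixed_pos hα₀ hα _ ase
      linarith
    have h1 : P.real {ω | (P⟦{ω' | actL (h T ω') ≠ ase} | past h T⟧) ω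
        ≤ cα * x⁻¹ + A * Real.exp E} = 1 := by
      rw [measureReal_def, measure_congr (Filter.eventuallyEq_univ.2 this), measure_univ,
        ENNReal.toReal_one]
    rw [h1]
    linarith
  have hgap := G.gapF_pos hbr
  have hδ1 : 1 ≤ Real.log (1 / δ) := by
    rw [Real.le_log_iff_exp_le (by positivity), le_div_iff₀ hδ₀]
    nlinarith [Real.exp_one_lt_three, Real.exp_pos 1]
  have hl1 : Real.log (1 / δ) ≤ Real.log (T / δ) :=
    Real.log_le_log (by positivity) (by gcongr)
  have hl : 1 ≤ Real.log (T / δ) := hδ1.trans hl1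
  have hlog2 : Real.log (2 / δ) = Real.log 2 + Real.log (1 / δ) := by
    rw [← Real.log_mul (by norm_num) (by positivity)]; congr 1; ring
  have hlog20 : 0 ≤ Real.log 2 := Real.log_nonneg (by norm_num)
  have hlog21 : Real.log 2 ≤ 1 := by linarith [Real.log_two_lt_d9]
  -- The last term of `E` is at least AB, while negativity of `E` keeps it below Δ₂x² ≤ x² ≤ T.
  have hABT : A * B ≤ T := by
    have hg1 : G.gapF br ≤ 1 := G.gapF_le_one
    have hL1 : G.gapL br ase ≤ 1 := G.gapL_le_one
    have h1 : 0 ≤ 2 * Real.sqrt (2 * A * Real.log (2 / δ)) * x := by positivity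
    have h2 : A * B ≤ 25 * A * B / G.gapF br ^ 2 * Real.log (T / δ) * Real.log (1 / δ) := by
      have hgi : 1 ≤ 1 / G.gapF br ^ 2 := by
        rw [le_div_iff₀ (by positivity), one_mul]; exact pow_le_one₀ hgap.le hg1
      calc A * B = 1 * A * B * 1 * 1 * 1 := by ring
        _ ≤ 25 * A * B * (1 / G.gapF br ^ 2) * Real.log (T / δ) * Real.log (1 / δ) := by
          gcongr; norm_num
        _ = _ := by ring
    have h3 : G.gapL br ase * x ^ 2 ≤ 1 * x ^ 2 := by gcongr
    have h4 : x ^ 2 ≤ x ^ 3 := pow_le_pow_right₀ hx1 (by norm_num)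
    linarith
  have hAT : A ≤ T := le_trans (le_mul_of_one_le_right (by linarith) hB) hABT
  have hlogA : 0 ≤ Real.log A := Real.log_nonneg hA
  set L := Real.log A + Real.log (1 / δ) with hLdef
  have hL0 : 0 < L := by linarith
  -- The union bound over leader actions costs log A. Either `cα` absorbs it, or δ ≤ T^(-3) and A ≤
  -- T give log A ≤ log(1/δ)/3, so that 3/4 of `L` is at most log(1/δ).
  have hL : 3 / 4 * L ≤ cα * Real.log (2 / δ) := by
    rcases hc with hc | hc
    · have : (1 + Real.log A) * Real.log (2 / δ) ≤ cα * Real.log (2 / δ) :=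
        mul_le_mul_of_nonneg_right hc (by linarith)
      nlinarith
    · have h1 : Real.log A ≤ Real.log T := Real.log_le_log (by linarith) hAT
      have h2 := Real.log_le_log hδ₀ hc
      rw [Real.log_rpow hT0] at h2
      have h3 : Real.log (1 / δ) = -Real.log δ := by rw [one_div, Real.log_inv]
      nlinarith
  have hadv := advantageBound_le_exponent (ase := ase) hgap hx3 hx1 hcα hL hl hδ1
    (by linarith)
  have hηadv : cη * x⁻¹ * advantageBound G br ase T δ (cα * x⁻¹) L ≤ E := by
    calc _ ≤ cη * x⁻¹ * (x * E) := mul_le_mul_of_nonneg_left hadv (by positivity)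
      _ = cη * E := by field_simp
      _ ≤ E := by nlinarith
  have hmain := run.measureReal_lastIterate_le (ase := ase) hbr hα₀ hα (by positivity) hT hl hL0
  rw [← hAdef, ← hBdef] at hmain
  set Bad := {ω | ¬ 1 - exp3 (cα * x⁻¹) (cη * x⁻¹) (fun τ => h τ ω) T ase
    ≤ cα * x⁻¹ + A * Real.exp (cη * x⁻¹ * advantageBound G br ase T δ (cα * x⁻¹) L)} with hBad
  have hprob : P.real Bad ≤ 3 * δ := by
    refine hmain.trans ?_
    have h1 : A * Real.exp (-L) = δ := by
      rw [hLdef, neg_add, Real.exp_add, ← Real.log_inv, ← Real.log_inv,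
        Real.exp_log (by positivity), Real.exp_log (by positivity)]
      field_simp
    have h2 := exp_neg_four_mul_log_div hT0 hδ₀
    have h3 : 2 * A * B * T ^ 2 * Real.exp (-(4 * Real.log (T / δ))) ≤ 2 * δ := by
      rw [mul_assoc, h2, ← mul_div_assoc, div_le_iff₀ (by positivity)]
      have h4 : δ ^ 4 ≤ δ := pow_le_of_le_one hδ₀.le (by linarith) (by norm_num)
      have h5 : (T : ℝ) ≤ T ^ 2 := le_self_pow₀ hT1 (by norm_num)
      calc 2 * A * B * δ ^ 4 = 2 * (A * B) * δ ^ 4 := by ring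
        _ ≤ 2 * (T ^ 2) * δ := by gcongr; exact hABT.trans h5
        _ = _ := by ring
    linarith
  -- Covering the whole space by the target event and `Bad` gives the lower bound by subadditivity
  -- alone.
  have hunion : (Set.univ : Set Ω) ≤ᵐ[P] (({ω | (P⟦{ω' | actL (h T ω') ≠ ase} | past h T⟧) ω
      ≤ cα * x⁻¹ + A * Real.exp E} ∪ Bad : Set Ω)) := by
    filter_upwards [hcond] with ω hω _
    change ω ∈ _ ∪ Bad
    by_cases hωB : ω ∈ Bad
    · exact Or.inr hωB
    · left
      change (P⟦{ω' | actL (h T ω') ≠ ase} | past h T⟧) ω ≤ cα * x⁻¹ + A * Real.exp E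
      rw [hω]
      refine (not_not.1 hωB).trans ?_
      gcongr
  have h1 := ENNReal.toReal_mono (measure_ne_top _ _) (measure_mono_ae hunion)
  rw [measure_univ, ENNReal.toReal_one] at h1
  have h2 := h1.trans (measureReal_union_le _ _)
  linarith

theorem exists_forall_measureReal_actL_ne_le (hbr : G.IsUniqueBestResponse br)
    (hse : G.IsUniqueStackelberg br ase) {cα cη β ε : ℝ} (hcα : 0 < cα) (hcη : 0 < cη)
    (hβ : 0 < β) (hε : 0 < ε) :
    ∃ T₀ : ℕ, ∀ (T : ℕ) (δ : ℝ), T₀ ≤ T → 0 < δ → δ < 1 → (T : ℝ) ^ (-β) ≤ δ →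
      ∀ (Ω : Type*) [MeasurableSpace Ω] (P : Measure Ω) [IsProbabilityMeasure P]
        (h : ℕ → Ω → Round 𝓐 𝓑),
      IsEXP3UCBRun G T δ (cα * (T : ℝ) ^ (-(1 / 3) : ℝ)) (cη * (T : ℝ) ^ (-(1 / 3) : ℝ)) P h →
      P.real {ω | actL (h T ω) ≠ ase} ≤ ε := by
  have hgF := G.gapF_pos hbr
  have hgL := G.gapL_pos hse
  have hgL1 : G.gapL br ase ≤ 1 := G.gapL_le_one
  set A : ℝ := (Fintype.card 𝓐 : ℝ) with hAdef
  set B : ℝ := (Fintype.card 𝓑 : ℝ) with hBdef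
  have hA : 1 ≤ A := Nat.one_le_cast.2 Fintype.card_pos
  have hB : 1 ≤ B := Nat.one_le_cast.2 Fintype.card_pos
  -- The error ε is split into four quarters: exploration, softmax tail, Bernstein failure and
  -- concentration failure. `L` handles the third and `M` the second; neither depends on T.
  set L : ℝ := max 1 (Real.log (4 * A / ε)) with hL
  have hL0 : 0 < L := lt_of_lt_of_le one_pos (le_max_left _ _)
  set M : ℝ := max 0 (Real.log (4 * A / ε) / cη) with hM
  have hM0 : 0 ≤ M := le_max_left _ _
  -- All positive terms of the advantage together are at most `K * x ^ 2`, against a drift of order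
  -- x³. The leading 1 pays for T-1 in the drift.
  set K : ℝ := 1 + 2 * Real.sqrt (3 / 2 * (A / cα) * L) + 2 * L * (A / cα)
    + A / cα * (2 * (B * (8 * ((1 + β) * 3) / G.gapF br ^ 2 + 1))) with hK
  have hlim : Filter.Tendsto (fun T : ℕ => (T : ℝ) ^ (1 / 3 : ℝ)) Filter.atTop Filter.atTop :=
    (tendsto_rpow_atTop (by norm_num)).comp tendsto_natCast_atTop_atTop
  obtain ⟨T₀, hT₀⟩ := Filter.eventually_atTop.1 (hlim.eventually_ge_atTop
    (max (max 3 (max cα (4 * cα / ε))) (max (8 * A * B / ε) ((K + M) / G.gapL br ase))))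
  refine ⟨T₀, fun T δ hT hδ₀ hδ1 hδβ Ω _ P _ h run => ?_⟩
  have hx := hT₀ T hT
  rw [rpow_neg_third] at run
  set x : ℝ := (T : ℝ) ^ (1 / 3 : ℝ) with hxdef
  have hx3 : x ^ 3 = T := cube_rpow_third T
  simp only [max_le_iff] at hx
  obtain ⟨⟨hx_3, hx_α, hx_ε⟩, hx_AB, hx_K⟩ := hx
  have hx0 : 0 < x := by linarith
  have hx1 : 1 ≤ x := by linarith
  have hxT : x ≤ T := by rw [← hx3]; exact le_self_pow₀ hx1 (by norm_num)
  have hT0 : (0 : ℝ) < T := by linarith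
  have hT1 : 1 ≤ T := by exact_mod_cast hx1.trans hxT
  have hα₀ : 0 < cα * x⁻¹ := by positivity
  have hα : cα * x⁻¹ ≤ 1 := by rw [← div_eq_mul_inv, div_le_one hx0]; exact hx_α
  have hαε : cα * x⁻¹ ≤ ε / 4 := by
    rw [← div_eq_mul_inv, div_le_iff₀ hx0]
    rw [div_le_iff₀ hε] at hx_ε
    linarith
  have hTδ : (T : ℝ) ≤ T / δ := le_div_self hT0.le hδ₀ hδ1.le
  have hl : 1 ≤ Real.log (T / δ) := by
    rw [Real.le_log_iff_exp_le (by positivity)]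
    linarith [Real.exp_one_lt_three]
  -- The only use of δ ≥ T^(-β): log(1/δ) is at most β log T, and log T = 3 log x ≤ 3x. This keeps
  -- the wrong-answer term at order x², uniformly in δ.
  have hl2 : Real.log (T / δ) ≤ (1 + β) * 3 * x := by
    have h1 : Real.log (T / δ) = Real.log T - Real.log δ := Real.log_div hT0.ne' hδ₀.ne'
    have h2 := Real.log_le_log (by positivity) hδβ
    rw [Real.log_rpow hT0] at h2
    have h3 : Real.log T = 3 * Real.log x := by rw [← hx3, Real.log_pow]; norm_num
    have h4 : Real.log x ≤ x := (Real.log_le_sub_one_of_pos hx0).trans (by linarith)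
    nlinarith
  have hadv : advantageBound G br ase T δ (cα * x⁻¹) L ≤ x * -M := by
    rw [advantageBound_eq G br ase δ cα L hx3, ← hAdef, ← hBdef]
    have t1 : G.gapL br ase ≤ 1 * x ^ 2 := by nlinarith
    have t2 : 2 * L * (A / cα) * x ≤ 2 * L * (A / cα) * x ^ 2 := by
      gcongr
      exact le_self_pow₀ hx1 (by norm_num)
    have t3 : A / cα * x * (2 * (B * (8 * Real.log (T / δ) / G.gapF br ^ 2 + 1)))
        ≤ A / cα * (2 * (B * (8 * ((1 + β) * 3) / G.gapF br ^ 2 + 1))) * x ^ 2 := by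
      calc _ ≤ A / cα * x * (2 * (B * (8 * ((1 + β) * 3 * x) / G.gapF br ^ 2 + x))) := by gcongr
        _ = _ := by ring
    have t4 : K + M ≤ G.gapL br ase * x := by
      rw [div_le_iff₀ hgL] at hx_K; linarith
    have t5 := mul_le_mul_of_nonneg_right t4 (sq_nonneg x)
    have t6 : M * x ≤ M * x ^ 2 := by
      gcongr
      exact le_self_pow₀ hx1 (by norm_num)
    have t7 : K * x ^ 2 = 1 * x ^ 2 + 2 * (Real.sqrt (3 / 2 * (A / cα) * L) * x ^ 2)
      + 2 * L * (A / cα) * x ^ 2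
      + A / cα * (2 * (B * (8 * ((1 + β) * 3) / G.gapF br ^ 2 + 1))) * x ^ 2 := by rw [hK]; ring
    linarith
  have hηadv : cη * x⁻¹ * advantageBound G br ase T δ (cα * x⁻¹) L ≤ -Real.log (4 * A / ε) := by
    calc _ ≤ cη * x⁻¹ * (x * -M) := mul_le_mul_of_nonneg_left hadv (by positivity)
      _ = -(cη * M) := by field_simp
      _ ≤ _ := by
        have : Real.log (4 * A / ε) / cη ≤ M := le_max_right _ _
        rw [div_le_iff₀ hcη] at this
        linarith
  have hexp : ∀ z, z ≤ -Real.log (4 * A / ε) → A * Real.exp z ≤ ε / 4 := fun z hz => by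
    calc A * Real.exp z ≤ A * Real.exp (-Real.log (4 * A / ε)) := by gcongr
      _ = ε / 4 := by
        rw [← Real.log_inv, Real.exp_log (by positivity)]
        field_simp
  have h1 := hexp _ hηadv
  have h2 := hexp (-L) (neg_le_neg (le_max_right _ _))
  have h3 : 2 * A * B * T ^ 2 * Real.exp (-(4 * Real.log (T / δ))) ≤ ε / 4 := by
    rw [mul_assoc, exp_neg_four_mul_log_div hT0 hδ₀, ← mul_div_assoc, div_le_iff₀ (by positivity)]
    have h4 : δ ^ 4 ≤ 1 := pow_le_one₀ hδ₀.le hδ1.le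
    have h5 : x ≤ T ^ 2 := hxT.trans (le_self_pow₀ (hx1.trans hxT) (by norm_num))
    rw [div_le_iff₀ hε] at hx_AB
    have h6 : 2 * A * B * δ ^ 4 ≤ 2 * A * B := mul_le_of_le_one_right (by positivity) h4
    have h7 := mul_le_mul_of_nonneg_right h5 hε.le
    linarith
  have hmain := run.measureReal_lastIterate_le (ase := ase) hbr hα₀ hα (by positivity) hT1 hl hL0
  have hfin := run.measureReal_actL_ne_le hT1 hα₀ hα ase
    (c := cα * x⁻¹ + A * Real.exp (cη * x⁻¹ * advantageBound G br ase T δ (cα * x⁻¹) L))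
    (by positivity)
  linarith

end

end StackelbergLearning

end

theorem theorem2 :
    (∃ C₁ : ℝ, 0 < C₁ ∧
      ∀ (𝓐 𝓑 : Type*) [Fintype 𝓐] [DecidableEq 𝓐] [Nontrivial 𝓐]
        [MeasurableSpace 𝓐] [DiscreteMeasurableSpace 𝓐]
        [Fintype 𝓑] [DecidableEq 𝓑] [Nontrivial 𝓑]
        [MeasurableSpace 𝓑] [DiscreteMeasurableSpace 𝓑]
        (G : StackelbergLearning.Game 𝓐 𝓑) (br : 𝓐 → 𝓑) (ase : 𝓐),
        G.IsUniqueBestResponse br → G.IsUniqueStackelberg br ase →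
        ∀ (T : ℕ) (δ cα cη α η : ℝ), 1 ≤ T → 0 < δ → δ < 1 →
        1 ≤ cα → 1 ≤ cη →
        (1 + Real.log (Fintype.card 𝓐) ≤ cα ∨ δ ≤ (T : ℝ) ^ (-3 : ℝ)) →
        α = cα * (T : ℝ) ^ (-(1 / 3) : ℝ) → α ≤ 1 →
        η = cη * (T : ℝ) ^ (-(1 / 3) : ℝ) →
        ∀ (Ω : Type*) [MeasurableSpace Ω] (P : MeasureTheory.Measure Ω)
          [MeasureTheory.IsProbabilityMeasure P]
          (h : ℕ → Ω → StackelbergLearning.Round 𝓐 𝓑),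
        StackelbergLearning.IsEXP3UCBRun G T δ α η P h →
        1 - 3 * δ ≤ P.real {ω |
          (P⟦{ω' | StackelbergLearning.actL (h T ω') ≠ ase} | StackelbergLearning.past h T⟧) ω
            ≤ α + Fintype.card 𝓐 * Real.exp (
                -(G.gapL br ase) * (T : ℝ) ^ (2 / 3 : ℝ)
                + 2 * Real.sqrt (2 * Fintype.card 𝓐 * Real.log (2 / δ)) * (T : ℝ) ^ (1 / 3 : ℝ)
                + C₁ * Fintype.card 𝓐 * Fintype.card 𝓑 / (G.gapF br) ^ 2
                    * Real.log (T / δ) * Real.log (1 / δ))})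
    ∧
    (∀ (𝓐 𝓑 : Type*) [Fintype 𝓐] [DecidableEq 𝓐] [Nontrivial 𝓐]
        [MeasurableSpace 𝓐] [DiscreteMeasurableSpace 𝓐]
        [Fintype 𝓑] [DecidableEq 𝓑] [Nontrivial 𝓑]
        [MeasurableSpace 𝓑] [DiscreteMeasurableSpace 𝓑]
        (G : StackelbergLearning.Game 𝓐 𝓑) (br : 𝓐 → 𝓑) (ase : 𝓐),
        G.IsUniqueBestResponse br → G.IsUniqueStackelberg br ase →
        ∀ (cα cη β ε : ℝ), 0 < cα → 0 < cη → 0 < β → 0 < ε →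
        ∃ T₀ : ℕ, ∀ (T : ℕ) (δ : ℝ), T₀ ≤ T → 0 < δ → δ < 1 → (T : ℝ) ^ (-β) ≤ δ →
        ∀ (Ω : Type*) [MeasurableSpace Ω] (P : MeasureTheory.Measure Ω)
          [MeasureTheory.IsProbabilityMeasure P]
          (h : ℕ → Ω → StackelbergLearning.Round 𝓐 𝓑),
        StackelbergLearning.IsEXP3UCBRun G T δ
          (cα * (T : ℝ) ^ (-(1 / 3) : ℝ)) (cη * (T : ℝ) ^ (-(1 / 3) : ℝ)) P h →
        P.real {ω | StackelbergLearning.actL (h T ω) ≠ ase} ≤ ε) := by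
  refine ⟨⟨25, by norm_num, ?_⟩, ?_⟩
  · intro 𝓐 𝓑 _ _ _ _ _ _ _ _ _ _ G br ase hbr _ T δ cα cη α η hT hδ₀ _ hcα hcη hc hα hα1 hη
      Ω _ P _ h run
    subst hα hη
    exact run.condExp_actL_ne_le hbr hT hδ₀ hcα hcη hc hα1
  · intro 𝓐 𝓑 _ _ _ _ _ _ _ _ _ _ G br ase hbr hse cα cη β ε hcα hcη hβ hε
    exact StackelbergLearning.exists_forall_measureReal_actL_ne_le hbr hse hcα hcη hβ hε
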